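/- Let $\alpha>0$. A random variable $Z\in[0,\infty]$ is *$\alpha$-Fréchet with scale* $\sigma\in[0,\infty]$ if $P(Z\le x)=\exp(-\sigma^\alpha x^{-\alpha})$ for all $x\in(0,\infty)$. An *$\alpha$-Fréchet process* $X=\{X_t\}_{t\in T}$ ($T\neq\emptyset$) is a real-valued max-stable process (for every $n\ge1$ there are $a_t>0$, $b_t\in\mathbb R$ such that the pointwise maximum of $n$ independent copies of $X$ has the finite-dimensional distributions of $\{a_tX_t+b_t\}_{t\in T}$) with $\alpha$-Fréchet marginals of finite scale; scale $0$, i.e. $X_t=0$ a.s., is allowed. $X$ satisfies *Condition S* if there is a countable $T_0\subset T$ such that every $X_t$ is the limit in probability of a sequence $X_{t_n}$ with $t_n\in T_0$. For a measure space $(S,\mathcal B_S,\mu)$ let $L^\alpha_+(S,\mu)$ be the set of measurable $f:S\to[0,\infty)$ with $\int f^\alpha\,d\mu<\infty$, with the metric $\int|f^\alpha-g^\alpha|\,d\mu$. An *$\alpha$-Fréchet random sup-measure* with control measure $\mu$ is a family $\{M_\alpha(A)\}_{A\in\mathcal B_S}$ of $[0,\infty]$-valued random variables such that $M_\alpha(A_1),\dots,M_\alpha(A_n)$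 are independent for disjoint $A_1,\dots,A_n$; $M_\alpha(A)$ is $\alpha$-Fréchet with scale $\mu(A)^{1/\alpha}$; and $M_\alpha(\bigcup_iA_i)=\bigvee_iM_\alpha(A_i)$ a.s. for disjoint $A_1,A_2,\dots$. The extremal integral is $\int^e f\,dM_\alpha=\bigvee_i a_iM_\alpha(A_i)$ for simple $f=\sum_i a_i1_{A_i}\in L^\alpha_+(S,\mu)$ with disjoint $A_i$, and it is extended to all $f\in L^\alpha_+(S,\mu)$ by continuity in probability. A family $\{f_t\}_{t\in T}\subset L^\alpha_+(S,\mu)$ is a *spectral representation* of $X$ if $\{X_t\}_{t\in T}$ and $\{\int^e f_t\,dM_\alpha\}_{t\in T}$ have the same finite-dimensional distributions, where $M_\alpha$ is an $\alpha$-Fréchet random sup-measure with control measure $\mu$. It is *minimal* if 1. the closure $\mathcal F$ in $L^\alpha_+(S,\mu)$ of the set of max-linear combinations $\bigvee_{i=1}^n a_if_{t_i}$ ($n\ge 1$, $a_i>0$) contains a function $f_0$ such that $\mu(\{g\ne0\}\setminus\{f_0\neq0\})=0$ for all $g\in\mathcal F$, and $\{f_0\ne0\}=S$ up to a $\mu$-null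 set; and 2. for every $B\in\mathcal B_S$ there is $A$ in the $\sigma$-field $\rho(\{f_t\})$ generated by the $[0,\infty]$-valued ratios $f_s/f_t$, $s,t\in T$ (with $0/0=0$), such that $\mu(A\,\triangle\,B)=0$. For $I\in\{0,1\}$ and $N\in\{0,1,2,\dots\}\cup\{\infty\}$ let $S_{I,N}$ be the disjoint union of $(0,1)$ if $I=1$ (of $\emptyset$ if $I=0$) and of $\{k\in\mathbb N: 1\le k\le N\}$, and let $\lambda_{I,N}$ be Lebesgue measure on $(0,1)$ plus counting measure on the integers of $S_{I,N}$. **Theorem.** Every $\alpha$-Fréchet process $X=\{X_t\}_{t\in T}$ satisfying Condition S has, for some $I\in\{0,1\}$ and $N\in\{0,1,2,\dots\}\cup\{\infty\}$, a minimal spectral representation $\{f_t\}_{t\in T}\subset L^\alpha_+(S_{I,N},\lambda_{I,N})$; in particular $$\{X_t\}_{t\in T}\overset{d}{=}\Big\{\int^{e}_{S_{I,N}}f_t\,dM_\alpha\Big\}_{t\in T},$$ where $M_\alpha$ is the $\alpha$-Fréchet random sup-measure with control measure $\lambda_{I,N}$. -/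

import Mathlib

open MeasureTheory ProbabilityTheory Filter Topology Set
open scoped NNReal ENNReal

noncomputable section

namespace FrechetProcess

universe u v

/-! ### Fréchet random variables and processes -/

/-- `Z` has the `α`-Fréchet distribution with scale coefficient `σ`:
`P (Z ≤ x) = exp (-(σ ^ α * x ^ (-α)))` for all `0 < x < ∞`. The scale `σ = 0` means `Z = 0` a.s.,
and the scale `σ = ∞` means `Z = ∞` a.s. -/
structure IsFrechet {Ω : Type u} [MeasurableSpace Ω] (α : ℝ) (σ : ℝ≥0∞) (Z : Ω → ℝ≥0∞)
    (P : Measure Ω) : Prop where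
  aemeasurable : AEMeasurable Z P
  cdf : ∀ x : ℝ≥0, 0 < x →
    P {ω | Z ω ≤ x} = EReal.exp (-((σ ^ α * (x : ℝ≥0∞) ^ (-α) : ℝ≥0∞) : EReal))

/-- Equality of the finite-dimensional distributions of two real processes, which may live on
different probability spaces. -/
def SameFDD {T : Type u} {Ω : Type*} {Ω' : Type*} [MeasurableSpace Ω] [MeasurableSpace Ω']
    (X : T → Ω → ℝ) (Y : T → Ω' → ℝ) (P : Measure Ω) (Q : Measure Ω') : Prop :=
  ∀ J : Finset T, IdentDistrib (fun ω (t : J) => X t ω) (fun ω (t : J) => Y t ω) P Q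

/-- Max-stability: for every `n ≥ 1` the pointwise maximum of `n` independent copies of `X` (built
on the `n`-fold product space) has the law of `a t * X t + b t`, for some `a t > 0` and `b t`. -/
def IsMaxStable {T : Type u} {Ω : Type v} [MeasurableSpace Ω] (X : T → Ω → ℝ)
    (P : Measure Ω) : Prop :=
  ∀ n : ℕ, 0 < n → ∃ a b : T → ℝ, (∀ t, 0 < a t) ∧
    SameFDD (fun t (ω : Fin n → Ω) => ⨆ i, X t (ω i)) (fun t ω => a t * X t ω + b t)
      (Measure.pi fun _ => P) P

/-- An `α`-Fréchet process: a max-stable process with `α`-Fréchet marginals. A vanishing scale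
coefficient (`X t = 0` a.s.) is allowed. -/
structure IsFrechetProcess {T : Type u} {Ω : Type v} [MeasurableSpace Ω] (α : ℝ) (X : T → Ω → ℝ)
    (P : Measure Ω) : Prop where
  nonneg : ∀ t, ∀ᵐ ω ∂P, 0 ≤ X t ω
  marginal : ∀ t, ∃ σ : ℝ≥0, IsFrechet α σ (fun ω => ENNReal.ofReal (X t ω)) P
  maxStable : IsMaxStable X P

/-- Condition S (separability in probability). -/
def ConditionS {T : Type u} {Ω : Type v} [MeasurableSpace Ω] (X : T → Ω → ℝ)
    (P : Measure Ω) : Prop :=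
  ∃ T₀ : Set T, T₀.Countable ∧
    ∀ t, ∃ τ : ℕ → T, (∀ n, τ n ∈ T₀) ∧ TendstoInMeasure P (fun n => X (τ n)) atTop (X t)

/-! ### Random sup-measures and extremal integrals -/

/-- `M` is an `α`-Fréchet random sup-measure with control measure `μ`. Only the values of `M` at
measurable sets matter; `M A = ∞` a.s. if `μ A = ∞`. -/
structure IsRandomSupMeasure {S : Type u} {Ω : Type v} [MeasurableSpace S] [MeasurableSpace Ω]
    (α : ℝ) (μ : Measure S) (M : Set S → Ω → ℝ≥0∞) (P : Measure Ω) : Prop where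
  indep : ∀ (n : ℕ) (A : Fin n → Set S), (∀ i, MeasurableSet (A i)) →
    Pairwise (Function.onFun Disjoint A) → iIndepFun (fun i => M (A i)) P
  frechet : ∀ A, MeasurableSet A → IsFrechet α (μ A ^ (1 / α)) (M A) P
  iUnion : ∀ A : ℕ → Set S, (∀ i, MeasurableSet (A i)) → Pairwise (Function.onFun Disjoint A) →
    ∀ᵐ ω ∂P, M (⋃ i, A i) ω = ⨆ i, M (A i) ω

/-- The space `L^α_+(S, μ)`. -/
def MemLPlus {S : Type u} [MeasurableSpace S] (α : ℝ) (μ : Measure S) (f : S → ℝ≥0) : Prop :=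
  Measurable f ∧ ∫⁻ s, (f s : ℝ≥0∞) ^ α ∂μ < ∞

/-- The metric `∫ |f ^ α - g ^ α| dμ` of `L^α_+(S, μ)`. -/
def distLPlus {S : Type u} [MeasurableSpace S] (α : ℝ) (μ : Measure S) (f g : S → ℝ≥0) : ℝ≥0∞ :=
  ∫⁻ s, ENNReal.ofReal |(f s : ℝ) ^ α - (g s : ℝ) ^ α| ∂μ

/-- The extremal integral of a simple function `φ = ∑ a 1_{φ = a}`, namely the maximum of
`a * M {φ = a}` over the finitely many values `a` of `φ`. -/
def simpleExtremalIntegral {S : Type u} {Ω : Type v} [MeasurableSpace S]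
    (M : Set S → Ω → ℝ≥0∞) (φ : SimpleFunc S ℝ≥0) (ω : Ω) : ℝ≥0∞ :=
  φ.range.sup fun a => (a : ℝ≥0∞) * M (φ ⁻¹' {a}) ω

/-- `Y` is (a version of) the extremal integral of `f` with respect to `M`: the limit in
probability of the extremal integrals of simple functions that converge to `f` in
`L^α_+(S, μ)`. -/
def IsExtremalIntegral {S : Type u} {Ω : Type v} [MeasurableSpace S] [MeasurableSpace Ω]
    (α : ℝ) (μ : Measure S) (M : Set S → Ω → ℝ≥0∞) (P : Measure Ω) (f : S → ℝ≥0)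
    (Y : Ω → ℝ) : Prop :=
  ∃ φ : ℕ → SimpleFunc S ℝ≥0, (∀ n, MemLPlus α μ (φ n)) ∧
    Tendsto (fun n => distLPlus α μ (φ n) f) atTop (𝓝 0) ∧
    TendstoInMeasure P (fun n ω => (simpleExtremalIntegral M (φ n) ω).toReal) atTop Y

/-- `{f t}` is a spectral representation of `X` over `L^α_+(S, μ)`: the finite-dimensional
distributions of `X` are those of the extremal integrals of the `f t` with respect to an
`α`-Fréchet random sup-measure with control measure `μ`. -/
def IsSpectralRepresentation {T : Type u} {Ω : Type v} {S : Type*} [MeasurableSpace Ω]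
    [MeasurableSpace S] (α : ℝ) (X : T → Ω → ℝ) (P : Measure Ω) (μ : Measure S)
    (f : T → S → ℝ≥0) : Prop :=
  (∀ t, MemLPlus α μ (f t)) ∧
  ∃ (Ω' : Type) (_ : MeasurableSpace Ω') (Q : Measure Ω') (_ : IsProbabilityMeasure Q)
    (M : Set S → Ω' → ℝ≥0∞) (Y : T → Ω' → ℝ), IsRandomSupMeasure α μ M Q ∧
      (∀ t, IsExtremalIntegral α μ M Q (f t) (Y t)) ∧ SameFDD X Y P Q

/-! ### Minimality -/

/-- The ratio `σ`-field, generated by all quotients `f / g` of members of `F`, with values in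
`[0, ∞]` (here `a / 0 = ∞` for `a > 0`, and `0 / 0 = 0`). -/
@[reducible] def ratioSigmaField {S : Type u} (F : Set (S → ℝ≥0)) : MeasurableSpace S :=
  ⨆ f ∈ F, ⨆ g ∈ F,
    MeasurableSpace.comap (fun s => (f s : ℝ≥0∞) / (g s : ℝ≥0∞)) inferInstance

/-- The max-linear combinations `⋁ a i * g i`, with `a i > 0`, of members of `F`. -/
def maxSpan {S : Type u} (F : Set (S → ℝ≥0)) : Set (S → ℝ≥0) :=
  {h | ∃ (n : ℕ) (a : Fin n → ℝ≥0) (g : Fin n → S → ℝ≥0), 0 < n ∧ (∀ i, 0 < a i) ∧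
    (∀ i, g i ∈ F) ∧ h = fun s => Finset.univ.sup fun i => a i * g i s}

/-- The closure of `maxSpan F` in `L^α_+(S, μ)`. -/
def closedMaxSpan {S : Type u} [MeasurableSpace S] (α : ℝ) (μ : Measure S)
    (F : Set (S → ℝ≥0)) : Set (S → ℝ≥0) :=
  {h | MemLPlus α μ h ∧ ∀ ε : ℝ≥0∞, 0 < ε → ∃ g ∈ maxSpan F, distLPlus α μ g h < ε}

/-- `f₀` has full support with respect to `F`. -/
def HasFullSupport {S : Type u} [MeasurableSpace S] (μ : Measure S) (F : Set (S → ℝ≥0))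
    (f₀ : S → ℝ≥0) : Prop :=
  ∀ g ∈ F, μ (Function.support g \ Function.support f₀) = 0

/-- Minimality of a family of spectral functions: its support, that is, the support of a function
of full support in the closed max-linear span, is all of `S` up to a null set, and every measurable
set agrees up to a null set with a set of the ratio `σ`-field. -/
structure IsMinimal {T : Type u} {S : Type v} [MeasurableSpace S] (α : ℝ) (μ : Measure S)
    (f : T → S → ℝ≥0) : Prop where
  support_eq : ∃ f₀ ∈ closedMaxSpan α μ (range f),
    HasFullSupport μ (closedMaxSpan α μ (range f)) f₀ ∧ Function.support f₀ =ᵐ[μ] univ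
  ratio : ∀ B : Set S, MeasurableSet B →
    ∃ A, MeasurableSet[ratioSigmaField (range f)] A ∧ μ (symmDiff A B) = 0

/-! ### The standardized support -/

/-- `S_{I,N}`: the interval `(0, 1)` if `I = 1` (and nothing if `I = 0`), together with the
integers `1 ≤ k ≤ N` (all positive integers if `N = ∞`). -/
def stdSupport (I : Fin 2) (N : ℕ∞) : Set ℝ :=
  {s | I = 1 ∧ s ∈ Ioo (0 : ℝ) 1} ∪ {s | ∃ k : ℕ, 1 ≤ k ∧ (k : ℕ∞) ≤ N ∧ s = k}

/-- `λ_{I,N}`: Lebesgue measure on the part of `S_{I,N}` in `(0, 1)`, counting measure on the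
integers in `S_{I,N}`. -/
def stdMeasure (I : Fin 2) (N : ℕ∞) : Measure (stdSupport I N) :=
  Measure.comap ((↑) : stdSupport I N → ℝ)
    (volume.restrict (Ioo (0 : ℝ) 1) + Measure.count.restrict (range ((↑) : ℕ → ℝ)))

end FrechetProcess

end

/-!
The process is reduced to the case `α = 1` by passing to `Y t = (X t) ^ α`. Max-stability of `X`
forces every weighted maximum `⋁ w t * Y t` over a finite set `J` to be `1`-Fréchet again
(`IsFrechetProcess.exists_hasFrechetLaw_sup`); write `V J w` for its scale, so that the joint
distribution functions of `Y` are `exp (-V J (1 / x))`. A family of functions `g t` on a measure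
space with `∫ ⋁ w t * g t = V J w` for all `J` and `w` is then all that a spectral representation
needs: the extremal integrals of such functions are realized as suprema over a Poisson cloud,
whose void probabilities give the same distribution functions
(`isRandomSupMeasure_supMeasure`, `isExtremalIntegral_supIntegral`, `poissonLaw_supIntegral_le`,
`isSpectralRepresentation_transport`).

The functions `g t` come from a compactness argument. For a countable set `T₀` there are positive
weights `c t` such that the variables `c t * Y t`, `t ∈ T₀`, are all dominated by one variable `Z`
with a `1`-Fréchet law (`exists_dominating`). The vectors `(c t * Y t / Z)` live in the compact
cube `[0, 1] ^ T₀`; their laws under the tilted measures proportional to `Z ^ p dP`, `p < 1`,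
cluster as `p → 1` at a probability measure, and `Q` is its multiple by the scale of `Z`. The
coordinates on `([0, 1] ^ T₀, Q)`, divided by `c t`, have the required integrals
(`exists_spectralMeasure`), because the moments of order `p < 1` of a `1`-Fréchet variable are
finite and homogeneous of degree `p` in its scale, so that the ratio of two such moments tends to
the ratio of the scales. The remaining `g t` are `L¹` limits of these along the sequences of
Condition S, because `∫ |g s - g t| = 2 ∫ max (g s) (g t) - ∫ g s - ∫ g t` is a function of `V`
(`exists_spectralFunctions`).

Minimality is built into this choice. The mass of `Q` equals the limit of the integrals of the
maxima of finitely many coordinates, so the supremum of all coordinates is `1` almost everywhere.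
Hence the constant `1` lies in the closed max-linear span, and every coordinate `k j` is the infimum
over `i` of the ratios `k j / k i`: the whole cube is determined by ratios. Both properties survive
multiplication by a positive density and transport along a map that is injective on a set of full
measure (`isMinimal_transport`). Such a map from `S_{I,N}` with its standard measure is found by
listing the atoms of `Q` and applying a quantile function to the diffuse part
(`exists_standardization`).
-/

namespace FrechetProcess

/-! ### The function `x ↦ exp (-x)` on `[0, ∞]` -/

/-- The decreasing bijection `x ↦ exp (-x)` from `[0, ∞]` onto `[0, 1]`. -/
noncomputable def expNeg (x : ℝ≥0∞) : ℝ≥0∞ := EReal.exp (-(x : EReal))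

lemma expNeg_zero : expNeg 0 = 1 := by simp [expNeg]

lemma expNeg_top : expNeg ∞ = 0 := by simp [expNeg]

lemma expNeg_strictAnti : StrictAnti expNeg := fun x y h => by
  unfold expNeg
  rw [EReal.exp_lt_exp_iff, EReal.neg_lt_neg_iff]
  exact_mod_cast h

lemma expNeg_add (x y : ℝ≥0∞) : expNeg (x + y) = expNeg x * expNeg y := by
  unfold expNeg
  rw [← EReal.exp_add, EReal.coe_ennreal_add, EReal.neg_add, sub_eq_add_neg]
  · left; simp
  · right; simp

lemma expNeg_sum {ι : Type*} (s : Finset ι) (f : ι → ℝ≥0∞) :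
    expNeg (∑ i ∈ s, f i) = ∏ i ∈ s, expNeg (f i) := by
  classical
  induction s using Finset.induction_on with
  | empty => simp [expNeg_zero]
  | insert a s ha ih => rw [Finset.sum_insert ha, Finset.prod_insert ha, expNeg_add, ih]

lemma continuous_expNeg : Continuous expNeg :=
  ENNReal.continuous_exp.comp (continuous_neg.comp continuous_coe_ennreal_ereal)

lemma expNeg_tsum {ι : Type*} (f : ι → ℝ≥0∞) : expNeg (∑' i, f i) = ∏' i, expNeg (f i) := by
  have h : HasProd (fun i => expNeg (f i)) (expNeg (∑' i, f i)) := by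
    have := (continuous_expNeg.tendsto _).comp (ENNReal.summable (f := f)).hasSum
    refine this.congr fun s => ?_
    simp [expNeg_sum]
  exact h.tprod_eq.symm

lemma expNeg_coe (x : ℝ≥0) : expNeg x = ENNReal.ofReal (Real.exp (-x)) := by
  rw [expNeg, ← EReal.exp_coe]
  rfl

lemma expNeg_eq_ofReal {x : ℝ≥0∞} (hx : x ≠ ∞) :
    expNeg x = ENNReal.ofReal (Real.exp (-x.toReal)) := by
  lift x to ℝ≥0 using hx
  rw [expNeg_coe]; rfl

/-! ### Poisson point processes -/

section Poisson

variable {E : Type*} [MeasurableSpace E]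

/-- Finite configurations of points of `E`, listed in some order. -/
abbrev FiniteConfig (E : Type*) := Σ k : ℕ, (Fin k → E)

/-- The configuration of the `k` points `x 0, …, x (k - 1)`. -/
abbrev FiniteConfig.mk {E : Type*} (k : ℕ) (x : Fin k → E) : FiniteConfig E := ⟨k, x⟩

/-- The law of the Poisson point process with finite intensity `m`: the number of points is
Poisson, and given that it is `k` the points form an i.i.d. `k`-tuple. -/
noncomputable def poissonCloud (m : Measure E) : Measure (FiniteConfig E) :=
  Measure.sum fun k => ENNReal.ofReal (Real.exp (-m.real univ) / k.factorial) •
    (Measure.pi fun _ : Fin k => m).map (FiniteConfig.mk k)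

lemma measurable_finiteConfigMk (k : ℕ) :
    Measurable (FiniteConfig.mk k : (Fin k → E) → FiniteConfig E) :=
  measurable_iff_le_map.2 (iInf_le _ k)

lemma measurableSet_avoid {B : Set E} (hB : MeasurableSet B) :
    MeasurableSet {c : FiniteConfig E | ∀ j, c.2 j ∉ B} := by
  refine MeasurableSpace.measurableSet_iInf.2 fun k => ?_
  change MeasurableSet {c : Fin k → E | ∀ j, c j ∉ B}
  simp only [ofPred_forall]
  exact MeasurableSet.iInter fun j => (measurable_pi_apply j hB).compl

/-- The void probabilities of a Poisson point process with finite intensity. -/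
lemma poissonCloud_avoid (m : Measure E) [IsFiniteMeasure m] {B : Set E} (hB : MeasurableSet B) :
    poissonCloud m {c : FiniteConfig E | ∀ j, c.2 j ∉ B} = expNeg (m B) := by
  have hk (k : ℕ) : (ENNReal.ofReal (Real.exp (-m.real univ) / k.factorial) •
      (Measure.pi fun _ : Fin k => m).map (FiniteConfig.mk k))
        {c : FiniteConfig E | ∀ j, c.2 j ∉ B} =
      ENNReal.ofReal (Real.exp (-m.real univ) * (m.real Bᶜ ^ k / k.factorial)) := by
    rw [Measure.smul_apply,
      Measure.map_apply (measurable_finiteConfigMk k) (measurableSet_avoid hB)]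
    have : FiniteConfig.mk k ⁻¹' {c : FiniteConfig E | ∀ j, c.2 j ∉ B}
        = Set.pi univ fun _ => Bᶜ := by
      ext; simp
    rw [this, Measure.pi_pi, Finset.prod_const, Finset.card_univ, Fintype.card_fin,
      ← ofReal_measureReal, ← ENNReal.ofReal_pow measureReal_nonneg, smul_eq_mul,
      ← ENNReal.ofReal_mul (by positivity)]
    congr 1
    ring
  have hs : HasSum (fun k : ℕ => Real.exp (-m.real univ) * (m.real Bᶜ ^ k / k.factorial))
      (Real.exp (-m.real univ) * Real.exp (m.real Bᶜ)) := by
    rw [Real.exp_eq_exp_ℝ]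
    exact (NormedSpace.expSeries_div_hasSum_exp (m.real Bᶜ)).mul_left _
  rw [poissonCloud, Measure.sum_apply _ (measurableSet_avoid hB)]
  simp_rw [hk]
  rw [← ENNReal.ofReal_tsum_of_nonneg (fun k => by positivity) hs.summable, hs.tsum_eq,
    ← Real.exp_add, expNeg_eq_ofReal (measure_ne_top _ _), measureReal_compl hB]
  congr 2
  simp only [measureReal_def]
  ring

instance (m : Measure E) [IsFiniteMeasure m] : IsProbabilityMeasure (poissonCloud m) where
  measure_univ := by
    have := poissonCloud_avoid m (MeasurableSet.empty (α := E))
    simpa [expNeg_zero] using this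

/-- The law of the Poisson point process with s-finite intensity `m`, as a superposition of
countably many independent Poisson point processes with finite intensities. -/
noncomputable def poissonLaw (m : Measure E) [SFinite m] :
    Measure (ℕ → FiniteConfig E) :=
  Measure.infinitePi fun n => poissonCloud (sfiniteSeq m n)

instance (m : Measure E) [SFinite m] : IsProbabilityMeasure (poissonLaw m) :=
  inferInstanceAs (IsProbabilityMeasure (Measure.infinitePi _))

lemma measurableSet_avoid_seq {B : Set E} (hB : MeasurableSet B) :
    MeasurableSet {ω : ℕ → FiniteConfig E | ∀ n j, (ω n).2 j ∉ B} := by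
  rw [ofPred_forall]
  exact MeasurableSet.iInter fun n =>
    (measurable_pi_apply (X := fun _ : ℕ => FiniteConfig E) n) (measurableSet_avoid hB)

/-- The void probabilities of a Poisson point process. -/
lemma poissonLaw_avoid (m : Measure E) [SFinite m] {B : Set E} (hB : MeasurableSet B) :
    poissonLaw m {ω | ∀ n j, (ω n).2 j ∉ B} = expNeg (m B) := by
  have : {ω : ℕ → FiniteConfig E | ∀ n j, (ω n).2 j ∉ B} =
      Set.pi univ fun _ => {c : FiniteConfig E | ∀ j, c.2 j ∉ B} := by
    ext; simp
  rw [this, poissonLaw, Measure.infinitePi_pi_univ _ fun _ => measurableSet_avoid hB]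
  simp_rw [poissonCloud_avoid _ hB]
  rw [← expNeg_tsum, ← Measure.sum_apply _ hB, sum_sfiniteSeq]

end Poisson

/-! ### The random sup-measure of a Poisson point process -/

section SupMeasure

variable {S : Type*} {α : ℝ}

/-- The supremum of `f s * t ^ (-1 / α)` over the points `(s, t)` of a configuration. If the points
are those of a Poisson process with intensity `μ ⊗ dt` on `S × (0, ∞)`, this is the extremal
integral of `f` with respect to an `α`-Fréchet random sup-measure with control measure `μ`. -/
noncomputable def supIntegral (α : ℝ) (f : S → ℝ≥0∞)
    (ω : ℕ → FiniteConfig (S × ℝ)) : ℝ≥0∞ :=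
  ⨆ n, ⨆ j, f ((ω n).2 j).1 * (ENNReal.ofReal ((ω n).2 j).2) ^ (-(1 / α))

lemma supIntegral_le_iff {f : S → ℝ≥0∞} {ω : ℕ → FiniteConfig (S × ℝ)} {x : ℝ≥0∞} :
    supIntegral α f ω ≤ x ↔
      ∀ n j, (ω n).2 j ∉ {p : S × ℝ | x < f p.1 * (ENNReal.ofReal p.2) ^ (-(1 / α))} := by
  simp [supIntegral]

lemma supIntegral_mono {f g : S → ℝ≥0∞} (h : f ≤ g) (ω : ℕ → FiniteConfig (S × ℝ)) :
    supIntegral α f ω ≤ supIntegral α g ω :=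
  iSup_mono fun _ => iSup_mono fun _ => mul_le_mul_left (h _) _

lemma supIntegral_iSup {ι : Sort*} (f : ι → S → ℝ≥0∞) (ω : ℕ → FiniteConfig (S × ℝ)) :
    supIntegral α (fun s => ⨆ i, f i s) ω = ⨆ i, supIntegral α (f i) ω := by
  simp only [supIntegral, ENNReal.iSup_mul]
  refine le_antisymm (iSup_le fun n => iSup_le fun j => iSup_le fun i => ?_)
    (iSup_le fun i => iSup_le fun n => iSup_le fun j => ?_)
  · exact le_iSup_of_le i (le_iSup_of_le n (le_iSup_of_le j le_rfl))
  · exact le_iSup_of_le n (le_iSup_of_le j (le_iSup_of_le i le_rfl))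

lemma supIntegral_finset_sup {ι : Type*} (J : Finset ι) (f : ι → S → ℝ≥0∞)
    (ω : ℕ → FiniteConfig (S × ℝ)) :
    supIntegral α (fun s => J.sup fun i => f i s) ω = J.sup fun i => supIntegral α (f i) ω := by
  simp only [Finset.sup_eq_iSup]
  rw [supIntegral_iSup (fun i s => ⨆ _ : i ∈ J, f i s)]
  refine iSup_congr fun i => ?_
  rw [supIntegral_iSup (ι := i ∈ J) (fun _ => f i)]

lemma supIntegral_const_mul (a : ℝ≥0∞) (f : S → ℝ≥0∞) (ω : ℕ → FiniteConfig (S × ℝ)) :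
    supIntegral α (fun s => a * f s) ω = a * supIntegral α f ω := by
  simp only [supIntegral, ENNReal.mul_iSup, mul_assoc]

variable [MeasurableSpace S]

lemma measurableSet_supIntegral_gt {f : S → ℝ≥0∞} (hf : Measurable f) (x : ℝ≥0∞) :
    MeasurableSet {p : S × ℝ | x < f p.1 * (ENNReal.ofReal p.2) ^ (-(1 / α))} :=
  measurableSet_lt measurable_const ((hf.comp measurable_fst).mul
    ((ENNReal.measurable_ofReal.comp measurable_snd).pow_const _))

lemma measurable_supIntegral {f : S → ℝ≥0∞} (hf : Measurable f) :
    Measurable (supIntegral α f) := by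
  refine measurable_of_Iic fun x => ?_
  have : supIntegral α f ⁻¹' Iic x = {ω | ∀ n j, (ω n).2 j ∉
      {p : S × ℝ | x < f p.1 * (ENNReal.ofReal p.2) ^ (-(1 / α))}} := by
    ext ω; exact supIntegral_le_iff
  rw [this]
  exact measurableSet_avoid_seq (measurableSet_supIntegral_gt hf x)

lemma lt_mul_rpow_neg_iff (hα : 0 < α) {a x : ℝ≥0∞} {t : ℝ} (ht : 0 < t) :
    x < a * (ENNReal.ofReal t) ^ (-(1 / α)) ↔ ENNReal.ofReal t < (a / x) ^ α := by
  obtain ⟨r, hr⟩ : ∃ r, r = (ENNReal.ofReal t) ^ (1 / α) := ⟨_, rfl⟩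
  have hr0 : r ≠ 0 := by
    simp [hr, ENNReal.rpow_eq_zero_iff, ht, not_lt.2 hα.le]
  have hr1 : r ≠ ∞ := hr ▸ ENNReal.rpow_ne_top_of_nonneg (by positivity) ENNReal.ofReal_ne_top
  have h1 : ENNReal.ofReal t = r ^ α := by
    rw [hr, ← ENNReal.rpow_mul, one_div_mul_cancel hα.ne', ENNReal.rpow_one]
  rw [ENNReal.rpow_neg, ← hr, h1, ENNReal.rpow_lt_rpow_iff hα, ← div_eq_mul_inv,
    ENNReal.lt_div_iff_mul_lt (.inl hr0) (.inl hr1),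
    ENNReal.lt_div_iff_mul_lt (.inr hr1) (.inr hr0), mul_comm]

lemma volume_ofReal_lt (a : ℝ≥0∞) :
    (volume.restrict (Ioi (0 : ℝ))) {t | ENNReal.ofReal t < a} = a := by
  rw [Measure.restrict_apply (measurableSet_lt ENNReal.measurable_ofReal measurable_const)]
  induction a with
  | top => simp
  | coe a =>
    have : {t | ENNReal.ofReal t < (a : ℝ≥0∞)} ∩ Ioi 0 = Ioo 0 (a : ℝ) := by
      ext t
      simp only [mem_inter_iff, mem_ofPred_eq, mem_Ioi, mem_Ioo]
      constructor
      · rintro ⟨h, h0⟩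
        rw [ENNReal.ofReal, ENNReal.coe_lt_coe, Real.toNNReal_lt_iff_lt_coe h0.le] at h
        exact ⟨h0, h⟩
      · rintro ⟨h0, h⟩
        rw [ENNReal.ofReal, ENNReal.coe_lt_coe, Real.toNNReal_lt_iff_lt_coe h0.le]
        exact ⟨h, h0⟩
    simp [this]

/-- The intensity of the Poisson process that carries the random sup-measure. -/
noncomputable def intensity (μ : Measure S) : Measure (S × ℝ) := μ.prod (volume.restrict (Ioi 0))

instance (μ : Measure S) [SFinite μ] : SFinite (intensity μ) :=
  inferInstanceAs (SFinite (μ.prod _))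

/-- The joint distribution function of extremal integrals. By the conventions `a / 0 = ∞` for
`a ≠ 0` and `a / ∞ = 0` it holds at all levels in `[0, ∞]`. -/
lemma poissonLaw_supIntegral_le (hα : 0 < α) (μ : Measure S) [SFinite μ] {ι : Type*}
    (J : Finset ι) (f : ι → S → ℝ≥0∞) (hf : ∀ i ∈ J, Measurable (f i)) (x : ι → ℝ≥0∞) :
    poissonLaw (intensity μ) {ω | ∀ i ∈ J, supIntegral α (f i) ω ≤ x i} =
      expNeg (∫⁻ s, J.sup (fun i => (f i s / x i) ^ α) ∂μ) := by
  set B : Set (S × ℝ) :=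
    ⋃ i ∈ J, {p : S × ℝ | x i < f i p.1 * (ENNReal.ofReal p.2) ^ (-(1 / α))} with hBdef
  have hB : MeasurableSet B :=
    Finset.measurableSet_biUnion _ fun i hi => measurableSet_supIntegral_gt (hf i hi) _
  have h1 : {ω : ℕ → FiniteConfig (S × ℝ) | ∀ i ∈ J, supIntegral α (f i) ω ≤ x i} =
      {ω | ∀ n j, (ω n).2 j ∉ B} := by
    ext ω
    simp only [mem_ofPred_eq, supIntegral_le_iff, hBdef, mem_iUnion, not_exists]
    exact ⟨fun h n j i hi => h i hi n j, fun h i hi n j => h n j i hi⟩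
  rw [h1, poissonLaw_avoid _ hB, intensity, Measure.prod_apply hB]
  congr 1
  refine lintegral_congr fun s => ?_
  rw [← volume_ofReal_lt (J.sup fun i => (f i s / x i) ^ α)]
  refine measure_congr ?_
  filter_upwards [ae_restrict_mem measurableSet_Ioi] with t ht
  apply propext
  change (s, t) ∈ B ↔ ENNReal.ofReal t < _
  rw [Finset.lt_sup_iff]
  simp only [hBdef, mem_iUnion, mem_ofPred_eq, exists_prop,
    lt_mul_rpow_neg_iff hα (show 0 < t from ht)]

/-- The random sup-measure `A ↦ ∫ᵉ 1_A`. -/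
noncomputable def supMeasure (α : ℝ) (A : Set S) :
    (ℕ → FiniteConfig (S × ℝ)) → ℝ≥0∞ :=
  supIntegral α (A.indicator 1)

lemma measurable_supMeasure {A : Set S} (hA : MeasurableSet A) :
    Measurable (supMeasure α A) :=
  measurable_supIntegral (measurable_one.indicator hA)

lemma iIndepFun_supMeasure (hα : 0 < α) (μ : Measure S) [SFinite μ] {n : ℕ} (A : Fin n → Set S)
    (hA : ∀ i, MeasurableSet (A i)) (hd : Pairwise (Function.onFun Disjoint A)) :
    iIndepFun (fun i => supMeasure α (A i)) (poissonLaw (intensity μ)) := by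
  refine iIndepSets.iIndep (fun i => (measurable_supMeasure (hA i)).comap_le)
    (fun i => preimage (supMeasure α (A i)) '' range Iic) (fun i => ?_) (fun i => ?_) ?_
  · have := (isPiSystem_image_Iic (univ : Set ℝ≥0∞)).comap (supMeasure α (A i))
    rw [image_univ] at this
    exact this
  · rw [BorelSpace.measurable_eq (α := ℝ≥0∞), borel_eq_generateFrom_Iic,
      MeasurableSpace.comap_generateFrom]
  · rw [iIndepSets_iff]
    intro J s hs
    have hs' (i : Fin n) : ∃ x : ℝ≥0∞, i ∈ J → s i = {ω | supMeasure α (A i) ω ≤ x} := by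
      by_cases hi : i ∈ J
      · obtain ⟨_, ⟨x, rfl⟩, hx⟩ := hs i hi
        exact ⟨x, fun _ => hx.symm⟩
      · exact ⟨0, fun h => absurd h hi⟩
    choose x hx using hs'
    have h1 : (⋂ i ∈ J, s i) = {ω | ∀ i ∈ J, supIntegral α ((A i).indicator 1) ω ≤ x i} := by
      ext ω
      simp only [mem_iInter, mem_ofPred_eq]
      exact forall₂_congr fun i hi => by rw [hx i hi]; rfl
    have h2 (i : Fin n) (hi : i ∈ J) : poissonLaw (intensity μ) (s i) =
        expNeg (∫⁻ s, ((A i).indicator (1 : S → ℝ≥0∞) s / x i) ^ α ∂μ) := by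
      have := poissonLaw_supIntegral_le hα μ {i} (fun i => (A i).indicator 1)
        (fun i _ => measurable_one.indicator (hA i)) x
      simp only [Finset.mem_singleton, forall_eq, Finset.sup_singleton] at this
      rw [hx i hi, ← this]; rfl
    rw [h1, poissonLaw_supIntegral_le hα μ J _ (fun i _ => measurable_one.indicator (hA i)),
      Finset.prod_congr rfl h2, ← expNeg_sum, ← lintegral_finsetSum]
    · congr 1
      refine lintegral_congr fun s => le_antisymm
        (Finset.sup_le fun i hi => Finset.single_le_sum
          (f := fun i => ((A i).indicator (1 : S → ℝ≥0∞) s / x i) ^ α) (fun _ _ => zero_le) hi) ?_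
      by_cases h : ∃ i ∈ J, s ∈ A i
      · obtain ⟨i, hi, his⟩ := h
        rw [Finset.sum_eq_single_of_mem i hi]
        · exact Finset.le_sup (f := fun i => ((A i).indicator (1 : S → ℝ≥0∞) s / x i) ^ α) hi
        · intro k _ hk
          have : s ∉ A k := fun hks => (hd hk).le_bot ⟨hks, his⟩
          simp [this, ENNReal.zero_rpow_of_pos hα]
      · push Not at h
        rw [Finset.sum_eq_zero]
        · exact zero_le
        · intro i hi
          simp [h i hi, ENNReal.zero_rpow_of_pos hα]
    · intro i _
      exact ((measurable_one.indicator (hA i)).div_const _).pow_const _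

theorem isRandomSupMeasure_supMeasure (hα : 0 < α) (μ : Measure S) [SFinite μ] :
    IsRandomSupMeasure α μ (supMeasure α) (poissonLaw (intensity μ)) where
  indep _ A hA hd := iIndepFun_supMeasure hα μ A hA hd
  frechet A hA := by
    refine ⟨(measurable_supMeasure hA).aemeasurable, fun x hx => ?_⟩
    have := poissonLaw_supIntegral_le hα μ {0} (fun _ : ℕ => A.indicator 1)
        (fun _ _ => measurable_one.indicator hA) (fun _ => x)
    simp only [Finset.mem_singleton, forall_eq, Finset.sup_singleton] at this
    rw [← ENNReal.rpow_mul, one_div_mul_cancel hα.ne', ENNReal.rpow_one]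
    refine this.trans ?_
    rw [expNeg]
    congr 3
    have h (s : S) : (A.indicator (1 : S → ℝ≥0∞) s / x) ^ α =
        A.indicator (fun _ => (x : ℝ≥0∞) ^ (-α)) s := by
      by_cases hs : s ∈ A
      · simp [hs, ENNReal.rpow_neg, ENNReal.inv_rpow]
      · simp [hs, ENNReal.zero_rpow_of_pos hα]
    simp_rw [h]
    rw [lintegral_indicator_const hA, mul_comm]
  iUnion A _ _ := by
    refine Eventually.of_forall fun ω => ?_
    rw [supMeasure]
    simp_rw [supMeasure]
    rw [← supIntegral_iSup]
    congr 1
    ext s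
    exact indicator_iUnion_apply rfl A 1 s

lemma simpleExtremalIntegral_supMeasure (φ : SimpleFunc S ℝ≥0)
    (ω : ℕ → FiniteConfig (S × ℝ)) :
    simpleExtremalIntegral (supMeasure α) φ ω = supIntegral α (fun s => φ s) ω := by
  rw [simpleExtremalIntegral]
  simp_rw [supMeasure, ← supIntegral_const_mul]
  rw [← supIntegral_finset_sup]
  congr 1
  ext s
  refine le_antisymm (Finset.sup_le fun a _ => ?_) ?_
  · by_cases h : s ∈ φ ⁻¹' {a}
    · rw [indicator_of_mem h]
      simp only [Pi.one_apply, mul_one, ENNReal.coe_le_coe]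
      exact (show φ s = a from h).ge
    · simp [indicator_of_notMem h]
  · refine le_trans ?_ (Finset.le_sup (φ.mem_range_self s))
    simp

lemma supIntegral_lt_top (hα : 0 < α) (μ : Measure S) [SFinite μ] {f : S → ℝ≥0}
    (hf : MemLPlus α μ f) :
    ∀ᵐ ω ∂poissonLaw (intensity μ), supIntegral α (fun s => f s) ω < ∞ := by
  have hm : Measurable fun s => (f s : ℝ≥0∞) := hf.1.coe_nnreal_ennreal
  have h (n : ℕ) : poissonLaw (intensity μ) {ω | supIntegral α (fun s => f s) ω ≤ n} =
      expNeg ((∫⁻ s, (f s : ℝ≥0∞) ^ α ∂μ) * ((n : ℝ≥0∞) ^ α)⁻¹) := by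
    have := poissonLaw_supIntegral_le hα μ {0} (fun _ : ℕ => fun s => (f s : ℝ≥0∞))
      (fun _ _ => hm) (fun _ => n)
    simp only [Finset.mem_singleton, forall_eq, Finset.sup_singleton] at this
    rw [this, ← lintegral_mul_const _ (hm.pow_const _)]
    congr 1
    refine lintegral_congr fun s => ?_
    rw [div_eq_mul_inv, ENNReal.mul_rpow_of_nonneg _ _ hα.le, ENNReal.inv_rpow]
  have hlim : Tendsto (fun n : ℕ => expNeg ((∫⁻ s, (f s : ℝ≥0∞) ^ α ∂μ) * ((n : ℝ≥0∞) ^ α)⁻¹))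
      atTop (𝓝 1) := by
    rw [← expNeg_zero]
    refine (continuous_expNeg.tendsto 0).comp ?_
    rw [← mul_zero (∫⁻ s, (f s : ℝ≥0∞) ^ α ∂μ)]
    refine ENNReal.Tendsto.const_mul ?_ (.inr hf.2.ne)
    have : Tendsto (fun n : ℕ => (n : ℝ≥0∞) ^ α) atTop (𝓝 ∞) :=
      (ENNReal.tendsto_rpow_at_top hα).comp ENNReal.tendsto_nat_nhds_top
    simpa using this.inv
  have h1 : poissonLaw (intensity μ) {ω | supIntegral α (fun s => f s) ω < ∞} = 1 := by
    refine le_antisymm prob_le_one (le_of_tendsto' hlim fun n => ?_)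
    rw [← h n]
    exact measure_mono fun ω hω => lt_of_le_of_lt hω (ENNReal.natCast_lt_top n)
  rw [ae_iff_prob_eq_one]
  · exact h1
  · exact (measurable_supIntegral hm).lt measurable_const

/-- The functional `supIntegral` is a version of the extremal integral. -/
theorem isExtremalIntegral_supIntegral (hα : 0 < α) (μ : Measure S) [SFinite μ] {f : S → ℝ≥0}
    (hf : MemLPlus α μ f) :
    IsExtremalIntegral α μ (supMeasure α) (poissonLaw (intensity μ)) f
      (fun ω => (supIntegral α (fun s => f s) ω).toReal) := by
  have hm : Measurable fun s => (f s : ℝ≥0∞) := hf.1.coe_nnreal_ennreal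
  obtain ⟨φ, hφ⟩ : ∃ φ : ℕ → SimpleFunc S ℝ≥0,
      ∀ n s, (φ n s : ℝ≥0∞) = SimpleFunc.eapprox (fun s => (f s : ℝ≥0∞)) n s :=
    ⟨fun n => (SimpleFunc.eapprox (fun s => (f s : ℝ≥0∞)) n).map ENNReal.toNNReal,
      fun n s => ENNReal.coe_toNNReal (SimpleFunc.eapprox_lt_top _ _ _).ne⟩
  have hmono (s : S) : Monotone fun n => (φ n s : ℝ≥0∞) := fun m n h => by
    simp only [hφ]; exact SimpleFunc.monotone_eapprox _ h s
  have hsup (s : S) : ⨆ n, (φ n s : ℝ≥0∞) = f s := by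
    simp only [hφ]; exact SimpleFunc.iSup_eapprox_apply hm s
  have hle (n : ℕ) (s : S) : φ n s ≤ f s := by
    rw [← ENNReal.coe_le_coe, ← hsup s]; exact le_iSup (fun n => (φ n s : ℝ≥0∞)) n
  have hlim (s : S) : Tendsto (fun n => φ n s) atTop (𝓝 (f s)) := by
    rw [← ENNReal.tendsto_coe, ← hsup s]; exact tendsto_atTop_iSup (hmono s)
  refine ⟨φ, fun n => ⟨(φ n).measurable, lt_of_le_of_lt (lintegral_mono fun s => ?_) hf.2⟩, ?_, ?_⟩
  · exact ENNReal.rpow_le_rpow (ENNReal.coe_le_coe.2 (hle n s)) hα.le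
  · unfold distLPlus
    rw [← lintegral_zero (μ := μ)]
    refine tendsto_lintegral_of_dominated_convergence (fun s => (f s : ℝ≥0∞) ^ α)
      (fun n => ?_) (fun n => Eventually.of_forall fun s => ?_) hf.2.ne
      (Eventually.of_forall fun s => ?_)
    · have h1 := (φ n).measurable
      have h2 := hf.1
      fun_prop
    · have h1 : (φ n s : ℝ) ^ α ≤ (f s : ℝ) ^ α :=
        Real.rpow_le_rpow (NNReal.coe_nonneg _) (hle n s) hα.le
      beta_reduce
      rw [← ENNReal.coe_rpow_of_nonneg _ hα.le, ENNReal.ofReal_le_iff_le_toReal ENNReal.coe_ne_top,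
        abs_sub_comm, abs_of_nonneg (sub_nonneg.2 h1), ENNReal.coe_toReal, NNReal.coe_rpow]
      exact sub_le_self _ (Real.rpow_nonneg (NNReal.coe_nonneg _) _)
    · have h1 : Tendsto (fun n => (φ n s : ℝ) ^ α) atTop (𝓝 ((f s : ℝ) ^ α)) :=
        (NNReal.tendsto_coe.2 (hlim s)).rpow_const (.inr hα.le)
      have h2 := ENNReal.tendsto_ofReal ((h1.sub_const ((f s : ℝ) ^ α)).abs)
      simpa using h2
  · simp_rw [simpleExtremalIntegral_supMeasure]
    refine tendstoInMeasure_of_tendsto_ae (fun n => ?_) ?_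
    · exact (measurable_supIntegral
        (φ n).measurable.coe_nnreal_ennreal).ennreal_toReal.aestronglyMeasurable
    · filter_upwards [supIntegral_lt_top hα μ hf] with ω hω
      refine (ENNReal.tendsto_toReal hω.ne).comp ?_
      have : (fun s => (f s : ℝ≥0∞)) = fun s => ⨆ n, (φ n s : ℝ≥0∞) := by ext s; rw [hsup]
      rw [this, supIntegral_iSup]
      exact tendsto_atTop_iSup fun m n h => supIntegral_mono (fun s => hmono s h) ω

end SupMeasure

/-! ### Max-stability and Fréchet laws -/

lemma expNeg_pow (x : ℝ≥0∞) (n : ℕ) : expNeg x ^ n = expNeg (n * x) := by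
  have := expNeg_sum (Finset.range n) fun _ => x
  simpa using this.symm

/-- The random variable `Z` has the `1`-Fréchet distribution with scale `v`. -/
structure HasFrechetLaw {Ω : Type*} [MeasurableSpace Ω] (P : Measure Ω) (Z : Ω → ℝ≥0) (v : ℝ≥0) :
    Prop where
  aemeasurable : AEMeasurable Z P
  cdf : ∀ y : ℝ≥0, 0 < y → P {ω | Z ω ≤ y} = expNeg (v / y : ℝ≥0)

/-- Cauchy's functional equation on `(0, ∞)`, for monotone functions: homogeneity under positive
integers forces linearity. -/
lemma eq_mul_of_monotone_of_nat_mul {L : ℝ → ℝ} (hmono : ∀ s t, 0 < s → s ≤ t → L s ≤ L t)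
    (hmul : ∀ (n : ℕ) (s : ℝ), 0 < n → 0 < s → L (n * s) = n * L s) {s : ℝ} (hs : 0 < s) :
    L s = s * L 1 := by
  have hnonneg (s : ℝ) (hs : 0 < s) : 0 ≤ L s := by
    have h1 := hmul 2 s two_pos hs
    have h2 := hmono s (2 * s) hs (by linarith)
    push_cast at h1
    linarith
  have hnat (m : ℕ) (hm : 0 < m) : L m = m * L 1 := by simpa using hmul m 1 hm one_pos
  have key (n : ℕ) (hn : 0 < n) : |L s - s * L 1| ≤ L 1 / n := by
    have hn' : (0 : ℝ) < n := Nat.cast_pos.2 hn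
    have hns : 0 < n * s := mul_pos hn' hs
    have h0 := hmul n s hn hs
    have hfl := Nat.floor_le hns.le
    have hlf := Nat.lt_floor_add_one (n * s : ℝ)
    have h1 : (L 1) ≥ 0 := hnonneg 1 one_pos
    have hup : L (n * s) ≤ (n * s + 1) * L 1 := by
      have h2 := hmono (n * s) ((⌊n * s⌋₊ + 1 : ℕ) : ℝ) hns (by push_cast; exact hlf.le)
      rw [hnat _ (Nat.succ_pos _)] at h2
      push_cast at h2
      nlinarith
    have hlow : (n * s - 1) * L 1 ≤ L (n * s) := by
      rcases Nat.eq_zero_or_pos ⌊n * s⌋₊ with h3 | h3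
      · rw [h3] at hlf
        have := hnonneg _ hns
        push_cast at hlf
        nlinarith
      · have h2 := hmono (⌊n * s⌋₊ : ℝ) (n * s) (Nat.cast_pos.2 h3) hfl
        rw [hnat _ h3] at h2
        nlinarith
    rw [abs_le, le_div_iff₀ hn', ← neg_div, div_le_iff₀ hn']
    constructor <;> nlinarith
  have hlim : Tendsto (fun n : ℕ => L 1 / n) atTop (𝓝 0) :=
    tendsto_const_div_atTop_nhds_zero_nat _
  have := ge_of_tendsto hlim (eventually_atTop.2 ⟨1, fun n hn => key n hn⟩)
  linarith [abs_eq_zero.1 (le_antisymm this (abs_nonneg _))]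

/-- A distribution function `F` on `[0, ∞)` with `F y ^ n = F (y / n)` is a `1`-Fréchet one. -/
lemma exists_hasFrechetLaw {Ω : Type*} [MeasurableSpace Ω] {P : Measure Ω} [IsProbabilityMeasure P]
    {Z : Ω → ℝ≥0} (hZ : AEMeasurable Z P)
    (h : ∀ (n : ℕ) (y : ℝ≥0), 0 < n → 0 < y → P {ω | Z ω ≤ y} ^ n = P {ω | Z ω ≤ y / n}) :
    ∃ v, HasFrechetLaw P Z v := by
  have hlim : Tendsto (fun n : ℕ => P {ω | Z ω ≤ n}) atTop (𝓝 1) := by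
    have h1 : (⋃ n : ℕ, {ω | Z ω ≤ n}) = univ := by
      ext ω; simpa using exists_nat_ge (Z ω)
    rw [← measure_univ (μ := P), ← h1]
    exact tendsto_measure_iUnion_atTop fun m n hmn ω (hω : Z ω ≤ m) =>
      hω.trans (Nat.cast_le.2 hmn)
  have hpos (y : ℝ≥0) (hy : 0 < y) : 0 < P.real {ω | Z ω ≤ y} := by
    obtain ⟨n, hn, hn0⟩ := ((hlim.eventually (lt_mem_nhds one_pos)).and
      (eventually_gt_atTop 0)).exists
    obtain ⟨k, hk⟩ := exists_nat_gt (n / y : ℝ≥0)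
    have hk0 : 0 < k := Nat.cast_pos.1 (lt_of_le_of_lt zero_le hk)
    have h1 := h k (k * y) hk0 (by positivity)
    rw [mul_div_cancel_left₀ _ (by positivity)] at h1
    have h2 : 0 < P {ω | Z ω ≤ k * y} := hn.trans_le (measure_mono fun ω (hω : Z ω ≤ n) =>
      hω.trans ((div_lt_iff₀ hy).1 hk).le)
    rw [measureReal_def, ← h1, ENNReal.toReal_pow]
    exact pow_pos (ENNReal.toReal_pos h2.ne' (measure_ne_top _ _)) _
  set F : ℝ → ℝ := fun s => P.real {ω | Z ω ≤ (1 / s).toNNReal} with hF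
  have hL := @eq_mul_of_monotone_of_nat_mul (fun s => -Real.log (F s))
    (fun s t hs hst => by
      refine neg_le_neg (Real.log_le_log (hpos _ ?_) ?_)
      · exact Real.toNNReal_pos.2 (one_div_pos.2 (hs.trans_le hst))
      · exact measureReal_mono fun ω (hω : Z ω ≤ _) =>
          hω.trans (Real.toNNReal_mono (one_div_le_one_div_of_le hs hst)))
    (fun n s hn hs => by
      have h1 := h n (1 / s).toNNReal hn (Real.toNNReal_pos.2 (one_div_pos.2 hs))
      have h2 : (1 / s).toNNReal / n = (1 / (n * s)).toNNReal := by
        rw [one_div, one_div, mul_inv, Real.toNNReal_mul (by positivity), mul_comm,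
          div_eq_inv_mul, Real.toNNReal_inv, Real.toNNReal_inv, Real.toNNReal_natCast, mul_comm]
      rw [h2] at h1
      have h3 : F s ^ n = F (n * s) := by
        simp only [hF, measureReal_def, ← h1, ENNReal.toReal_pow]
      rw [← h3, Real.log_pow]; ring)
  have hone : 0 ≤ -Real.log (F 1) := by
    rw [neg_nonneg]
    exact Real.log_nonpos measureReal_nonneg measureReal_le_one
  refine ⟨(-Real.log (F 1)).toNNReal, hZ, fun y hy => ?_⟩
  have hy' : (0 : ℝ) < y := hy
  have h1 := hL (one_div_pos.2 hy')
  have h2 : F (1 / y) = P.real {ω | Z ω ≤ y} := by simp [hF]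
  simp only [h2] at h1
  rw [expNeg_coe, ← ofReal_measureReal]
  congr 1
  rw [← Real.exp_log (hpos y hy)]
  congr 1
  rw [NNReal.coe_div, Real.coe_toNNReal _ hone, div_eq_mul_one_div, mul_comm, ← h1, neg_neg]

section MaxStable

variable {T : Type*} {Ω : Type*} [MeasurableSpace Ω] {P : Measure Ω} {α : ℝ} {X : T → Ω → ℝ}

/-- The power `X ^ α` of a process, with values in `[0, ∞)`. It turns an `α`-Fréchet process into
a `1`-Fréchet process. -/
noncomputable def powProcess (α : ℝ) (X : T → Ω → ℝ) (t : T) (ω : Ω) : ℝ≥0 :=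
  (X t ω).toNNReal ^ α

lemma IsFrechetProcess.aemeasurable (hX : IsFrechetProcess α X P) (t : T) :
    AEMeasurable (X t) P := by
  obtain ⟨σ, hσ⟩ := hX.marginal t
  refine hσ.aemeasurable.ennreal_toReal.congr ?_
  filter_upwards [hX.nonneg t] with ω hω
  exact ENNReal.toReal_ofReal hω

lemma aemeasurable_powProcess (hX : ∀ t, AEMeasurable (X t) P) (t : T) :
    AEMeasurable (powProcess α X t) P :=
  (hX t).real_toNNReal.pow_const α

lemma aemeasurable_finset_sup {Ω ι : Type*} [MeasurableSpace Ω] {P : Measure Ω} {U : ι → Ω → ℝ≥0}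
    (J : Finset ι) (hU : ∀ i ∈ J, AEMeasurable (U i) P) :
    AEMeasurable (fun ω => J.sup fun i => U i ω) P := by
  classical
  induction J using Finset.induction_on with
  | empty => exact aemeasurable_const
  | insert a s ha ih =>
    simp only [Finset.sup_insert]
    exact (hU a (Finset.mem_insert_self a s)).sup
      (ih fun i hi => hU i (Finset.mem_insert_of_mem hi))

lemma measurable_finset_sup {Ω ι : Type*} [MeasurableSpace Ω] {U : ι → Ω → ℝ≥0}
    (J : Finset ι) (hU : ∀ i ∈ J, Measurable (U i)) :
    Measurable (fun ω => J.sup fun i => U i ω) := by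
  classical
  induction J using Finset.induction_on with
  | empty => exact measurable_const
  | insert a s ha ih =>
    simp only [Finset.sup_insert]
    exact (hU a (Finset.mem_insert_self a s)).sup
      (ih fun i hi => hU i (Finset.mem_insert_of_mem hi))

/-- The normalizing constants of an `α`-Fréchet process are `a t = n ^ (1 / α)` and `b t = 0`,
unless `X t = 0` a.s. In both cases `(a t * X t + b t) ^ α = n * X t ^ α` a.s. -/
lemma IsFrechetProcess.powProcess_affine (hα : 0 < α) [IsProbabilityMeasure P]
    (hX : IsFrechetProcess α X P) {n : ℕ} (hn : 0 < n) {t : T} {a b : ℝ} (ha : 0 < a)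
    (h : ∀ c : ℝ, P {ω | X t ω ≤ c} ^ n = P {ω | a * X t ω + b ≤ c}) :
    ∀ᵐ ω ∂P, (a * X t ω + b).toNNReal ^ α = n * powProcess α X t ω := by
  obtain ⟨σ, hσ⟩ := hX.marginal t
  have hF (c : ℝ) (hc : 0 < c) : P {ω | X t ω ≤ c} =
      expNeg ((σ : ℝ≥0∞) ^ α * (c.toNNReal : ℝ≥0∞) ^ (-α)) := by
    refine Eq.trans ?_ (hσ.cdf c.toNNReal (Real.toNNReal_pos.2 hc))
    congr 1
    ext ω
    exact (ENNReal.ofReal_le_ofReal_iff hc.le).symm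
  have hneg (c : ℝ) (hc : c < 0) : P {ω | X t ω ≤ c} = 0 := by
    refine measure_mono_null ?_ (ae_iff.1 (hX.nonneg t))
    intro ω (hω : X t ω ≤ c)
    exact not_le.2 (hω.trans_lt hc)
  have hab (c : ℝ) : P {ω | X t ω ≤ c} ^ n = P {ω | X t ω ≤ (c - b) / a} := by
    rw [h c]
    congr 1
    ext ω
    simp only [mem_ofPred_eq]
    rw [le_div_iff₀ ha]
    constructor <;> intro <;> linarith
  rcases eq_or_ne σ 0 with rfl | hσ0
  · have h0 : ∀ᵐ ω ∂P, X t ω = 0 := by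
      have h1 (k : ℕ) : ∀ᵐ ω ∂P, X t ω ≤ 1 / ((k : ℝ) + 1) := by
        refine (mem_ae_iff_prob_eq_one₀
          (nullMeasurableSet_le (hX.aemeasurable t) aemeasurable_const)).2 ?_
        rw [hF _ (by positivity), ENNReal.coe_zero, ENNReal.zero_rpow_of_pos hα, zero_mul,
          expNeg_zero]
      filter_upwards [ae_all_iff.2 h1, hX.nonneg t] with ω h2 h3
      exact le_antisymm (ge_of_tendsto' tendsto_one_div_add_atTop_nhds_zero_nat h2) h3
    have hcdf (c : ℝ) : P {ω | X t ω ≤ c} = if 0 ≤ c then 1 else 0 := by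
      have : P {ω | X t ω ≤ c} = P {_ω | 0 ≤ c} :=
        measure_congr (h0.mono fun ω hω => by
          apply propext
          change X t ω ≤ c ↔ 0 ≤ c
          rw [hω])
      rw [this]
      split_ifs with hc <;> simp [hc]
    have hb1 : b ≤ 0 := by
      have := hab 0
      rw [hcdf, hcdf, if_pos le_rfl, one_pow] at this
      by_contra! hb
      rw [if_neg (not_le.2 (div_neg_of_neg_of_pos (by linarith) ha))] at this
      exact one_ne_zero this
    have hb2 : 0 ≤ b := by
      refine le_of_forall_lt fun c hc => ?_
      have := hab c
      rw [hcdf, hcdf, if_neg (not_le.2 hc), zero_pow hn.ne'] at this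
      by_contra! hb
      rw [if_pos (div_nonneg (by linarith) ha.le)] at this
      exact one_ne_zero this.symm
    filter_upwards [h0] with ω hω
    simp [powProcess, hω, le_antisymm hb1 hb2, NNReal.zero_rpow hα.ne']
  · have hv0 : (σ : ℝ≥0∞) ^ α ≠ 0 := by simp [ENNReal.rpow_eq_zero_iff, hσ0, not_lt.2 hα.le]
    have hv1 : (σ : ℝ≥0∞) ^ α ≠ ∞ := ENNReal.rpow_ne_top_of_nonneg hα.le ENNReal.coe_ne_top
    have hpos (c : ℝ) (hc : 0 < c) : P {ω | X t ω ≤ c} ≠ 0 := by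
      rw [hF c hc, ← expNeg_top]
      refine (expNeg_strictAnti (ENNReal.mul_lt_top hv1.lt_top ?_)).ne'
      rw [← ENNReal.coe_rpow_of_ne_zero (Real.toNNReal_pos.2 hc).ne']
      exact ENNReal.coe_lt_top
    have hzero (c : ℝ) (hc : c ≤ 0) : P {ω | X t ω ≤ c} = 0 := by
      have hlim : Tendsto (fun k : ℕ => expNeg ((σ : ℝ≥0∞) ^ α *
          ((1 / ((k : ℝ) + 1)).toNNReal : ℝ≥0∞) ^ (-α))) atTop (𝓝 0) := by
        rw [← expNeg_top]
        refine (continuous_expNeg.tendsto _).comp ?_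
        have h1 : Tendsto (fun k : ℕ => ENNReal.ofReal (1 / ((k : ℝ) + 1)) ^ (-α)) atTop (𝓝 ∞) := by
          have h2 := ENNReal.tendsto_ofReal (tendsto_one_div_add_atTop_nhds_zero_nat (𝕜 := ℝ))
          have h3 := ((ENNReal.continuous_rpow_const (y := -α)).tendsto _).comp h2
          simpa [hα, Function.comp_def] using h3
        rw [← ENNReal.mul_top hv0]
        exact ENNReal.Tendsto.const_mul h1 (.inl ENNReal.top_ne_zero)
      refine le_antisymm (ge_of_tendsto' hlim fun k => ?_) zero_le
      rw [← hF _ (by positivity)]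
      exact measure_mono fun ω (hω : X t ω ≤ c) => (hω.trans hc).trans (by positivity)
    have hb : b = 0 := by
      refine le_antisymm (le_of_forall_gt fun c hc => ?_) ?_
      · by_contra! hb
        have := hab c
        rw [hzero ((c - b) / a) (div_nonpos_of_nonpos_of_nonneg (by linarith) ha.le)] at this
        exact hpos c hc (pow_eq_zero_iff hn.ne' |>.1 this)
      · by_contra! hb
        have := hab 0
        rw [hzero 0 le_rfl, zero_pow hn.ne'] at this
        exact hpos _ (div_pos (by linarith) ha) this.symm
    have haα : a.toNNReal ^ α = n := by
      have h1 := hab a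
      rw [hb, sub_zero, div_self ha.ne', hF a ha, hF 1 one_pos, expNeg_pow,
        expNeg_strictAnti.injective.eq_iff] at h1
      have ha' : a.toNNReal ≠ 0 := (Real.toNNReal_pos.2 ha).ne'
      rw [mul_left_comm, ENNReal.mul_right_inj hv0 hv1, ← ENNReal.coe_rpow_of_ne_zero ha',
        Real.toNNReal_one, ENNReal.coe_one, ENNReal.one_rpow] at h1
      have h2 : (n : ℝ≥0) * a.toNNReal ^ (-α) = 1 := by exact_mod_cast h1
      rw [NNReal.rpow_neg, ← div_eq_mul_inv, div_eq_one_iff_eq] at h2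
      · exact h2.symm
      · exact (NNReal.rpow_pos (Real.toNNReal_pos.2 ha)).ne'
    filter_upwards with ω
    rw [hb, add_zero, Real.toNNReal_mul ha.le, NNReal.mul_rpow, haα, powProcess]

/-- Max-stability of `X ^ α`, as an identity for the distribution functions of max-linear
combinations. -/
lemma IsFrechetProcess.pow_measure_sup_le (hα : 0 < α) [IsProbabilityMeasure P]
    (hX : IsFrechetProcess α X P) (J : Finset T) (w : T → ℝ≥0) {n : ℕ} (hn : 0 < n) (y : ℝ≥0) :
    P {ω | (J.sup fun t => w t * powProcess α X t ω) ≤ y} ^ n =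
      P {ω | (J.sup fun t => w t * powProcess α X t ω) ≤ y / n} := by
  obtain ⟨a, b, ha, hfdd⟩ := hX.maxStable n hn
  have : Nonempty (Fin n) := ⟨⟨0, hn⟩⟩
  have hn' : (0 : ℝ≥0) < n := Nat.cast_pos.2 hn
  -- a finite maximum satisfies a monotone condition iff all its members do
  have hsup (p : ℝ → Prop) (hp : ∀ x y, x ≤ y → p y → p x) (x : Fin n → ℝ) :
      p (⨆ i, x i) ↔ ∀ i, p (x i) := by
    constructor
    · exact fun h i => hp _ _ (le_ciSup (Set.finite_range x).bddAbove i) h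
    · intro h
      obtain ⟨i, hi⟩ := exists_eq_ciSup_of_finite (f := x)
      exact hi ▸ h i
  have hpow (A : Set Ω) : P A ^ n = (Measure.pi fun _ : Fin n => P) {ω | ∀ i, ω i ∈ A} := by
    have : {ω : Fin n → Ω | ∀ i, ω i ∈ A} = Set.pi univ fun _ => A := by ext; simp
    rw [this, Measure.pi_pi]
    simp
  have haff (t : T) : ∀ᵐ ω ∂P, (a t * X t ω + b t).toNNReal ^ α = n * powProcess α X t ω := by
    refine hX.powProcess_affine hα hn (ha t) fun c => ?_
    rw [hpow]
    have h1 := (hfdd {t}).measure_mem_eq (s := {x | x ⟨t, Finset.mem_singleton_self t⟩ ≤ c})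
      (measurableSet_le (measurable_pi_apply _) measurable_const)
    refine Eq.trans ?_ h1
    congr 1
    ext ω
    exact (hsup (fun x => x ≤ c) (fun x y h1 h2 => h1.trans h2) fun i => X t (ω i)).symm
  have hms : MeasurableSet {x : J → ℝ | ∀ t : J, w t * (x t).toNNReal ^ α ≤ y} := by
    rw [ofPred_forall]
    refine MeasurableSet.iInter fun t => measurableSet_le ?_ measurable_const
    exact (((measurable_pi_apply t).real_toNNReal).pow_const α).const_mul _
  have h1 := (hfdd J).measure_mem_eq hms
  rw [hpow]
  refine Eq.trans ?_ (h1.trans ?_)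
  · congr 1
    ext ω
    simp only [mem_ofPred_eq, mem_preimage, Finset.sup_le_iff]
    have h2 (t : T) := hsup (fun x => w t * x.toNNReal ^ α ≤ y) (fun x z hxz hz =>
      (mul_le_mul_right (NNReal.rpow_le_rpow (Real.toNNReal_mono hxz) hα.le) _).trans hz)
      fun i => X t (ω i)
    exact ⟨fun h t => (h2 t).2 fun i => h i t t.2, fun h i t ht => (h2 t).1 (h ⟨t, ht⟩) i⟩
  · refine measure_congr ?_
    have h3 : ∀ᵐ ω ∂P, ∀ t : J,
        (a t * X t ω + b t).toNNReal ^ α = n * powProcess α X t ω := ae_all_iff.2 fun t => haff t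
    filter_upwards [h3] with ω hω
    apply propext
    change (∀ t : J, w t * (a t * X t ω + b t).toNNReal ^ α ≤ y) ↔
      (J.sup fun t => w t * powProcess α X t ω) ≤ y / n
    simp only [Finset.sup_le_iff]
    constructor
    · intro h t ht
      have := h ⟨t, ht⟩
      rw [hω ⟨t, ht⟩] at this
      rwa [le_div_iff₀ hn', mul_assoc, mul_comm _ (n : ℝ≥0)]
    · intro h t
      rw [hω t, mul_comm (n : ℝ≥0), ← mul_assoc, ← le_div_iff₀ hn']
      exact h t t.2

/-- The max-linear combinations of a max-stable process are Fréchet. -/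
theorem IsFrechetProcess.exists_hasFrechetLaw_sup (hα : 0 < α) [IsProbabilityMeasure P]
    (hX : IsFrechetProcess α X P) (J : Finset T) (w : T → ℝ≥0) :
    ∃ v, HasFrechetLaw P (fun ω => J.sup fun t => w t * powProcess α X t ω) v :=
  exists_hasFrechetLaw (aemeasurable_finset_sup J fun t _ =>
      (aemeasurable_powProcess hX.aemeasurable t).const_mul (w t))
    fun _ y hn _ => hX.pow_measure_sup_le hα J w hn y

end MaxStable

/-! ### Moments and limits of Fréchet laws -/

section Law

variable {Ω : Type*} [MeasurableSpace Ω] {P : Measure Ω} {Z Z' : Ω → ℝ≥0} {v v' : ℝ≥0}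

lemma HasFrechetLaw.unique (h : HasFrechetLaw P Z v) (h' : HasFrechetLaw P Z v') : v = v' := by
  have h1 := (h.cdf 1 one_pos).symm.trans (h'.cdf 1 one_pos)
  have h2 := expNeg_strictAnti.injective h1
  simpa using h2

lemma HasFrechetLaw.congr (h : HasFrechetLaw P Z v) (hZ : Z =ᵐ[P] Z') : HasFrechetLaw P Z' v where
  aemeasurable := h.aemeasurable.congr hZ
  cdf y hy := by
    rw [← h.cdf y hy]
    refine measure_congr (hZ.mono fun ω hω => ?_)
    apply propext
    change Z' ω ≤ y ↔ Z ω ≤ y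
    rw [hω]

/-- Larger random variables have larger scales. -/
lemma HasFrechetLaw.mono (h : HasFrechetLaw P Z v) (h' : HasFrechetLaw P Z' v')
    (hZ : ∀ᵐ ω ∂P, Z ω ≤ Z' ω) : v ≤ v' := by
  have h1 : P {ω | Z' ω ≤ 1} ≤ P {ω | Z ω ≤ 1} :=
    measure_mono_ae (hZ.mono fun ω hω (hω' : Z' ω ≤ 1) => hω.trans hω')
  rw [h.cdf 1 one_pos, h'.cdf 1 one_pos, expNeg_strictAnti.le_iff_ge] at h1
  simpa using h1

lemma HasFrechetLaw.const_mul [IsProbabilityMeasure P] (h : HasFrechetLaw P Z v) (a : ℝ≥0) :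
    HasFrechetLaw P (fun ω => a * Z ω) (a * v) where
  aemeasurable := h.aemeasurable.const_mul a
  cdf y hy := by
    rcases eq_or_ne a 0 with rfl | ha
    · simp [expNeg_zero]
    · have ha' : 0 < a := pos_iff_ne_zero.2 ha
      have h1 := h.cdf (y / a) (by positivity)
      have h2 : {ω | a * Z ω ≤ y} = {ω | Z ω ≤ y / a} := by
        ext ω
        simp only [mem_ofPred_eq]
        rw [le_div_iff₀ ha', mul_comm]
      rw [h2, h1, div_div_eq_mul_div, mul_comm a v]

lemma HasFrechetLaw.measure_gt [IsProbabilityMeasure P] (h : HasFrechetLaw P Z v) {y : ℝ≥0}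
    (hy : 0 < y) : P {ω | y < Z ω} = 1 - expNeg (v / y : ℝ≥0) := by
  rw [← h.cdf y hy,
    ← prob_compl_eq_one_sub₀ (nullMeasurableSet_le h.aemeasurable aemeasurable_const)]
  congr 1
  ext ω
  simp

lemma one_sub_expNeg_le (x : ℝ≥0∞) : 1 - expNeg x ≤ x := by
  induction x with
  | top => exact le_top
  | coe x =>
    rw [expNeg_coe, ← ENNReal.ofReal_one, ← ENNReal.ofReal_sub _ (Real.exp_pos _).le,
      ← ENNReal.ofReal_coe_nnreal]
    refine ENNReal.ofReal_le_ofReal ?_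
    linarith [Real.add_one_le_exp (-(x : ℝ))]

lemma HasFrechetLaw.measure_gt_le [IsProbabilityMeasure P] (h : HasFrechetLaw P Z v) {y : ℝ≥0}
    (hy : 0 < y) : P {ω | y < Z ω} ≤ (v / y : ℝ≥0) :=
  (h.measure_gt hy).trans_le (one_sub_expNeg_le _)

lemma HasFrechetLaw.lintegral_rpow [IsProbabilityMeasure P] (h : HasFrechetLaw P Z v) {p : ℝ}
    (hp : 0 < p) : ∫⁻ ω, (Z ω : ℝ≥0∞) ^ p ∂P = ENNReal.ofReal p * ∫⁻ t in Ioi (0 : ℝ),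
      (1 - expNeg (v / t.toNNReal : ℝ≥0)) * ENNReal.ofReal (t ^ (p - 1)) := by
  have h1 := lintegral_rpow_eq_lintegral_meas_lt_mul P (f := fun ω => (Z ω : ℝ))
    (Eventually.of_forall fun ω => NNReal.coe_nonneg _) h.aemeasurable.coe_nnreal_real hp
  have h2 (ω : Ω) : ENNReal.ofReal ((Z ω : ℝ) ^ p) = (Z ω : ℝ≥0∞) ^ p := by
    rw [← ENNReal.ofReal_rpow_of_nonneg (NNReal.coe_nonneg _) hp.le, ENNReal.ofReal_coe_nnreal]
  simp only [h2] at h1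
  rw [h1]
  congr 1
  refine setLIntegral_congr_fun measurableSet_Ioi fun t ht => ?_
  rw [← h.measure_gt (Real.toNNReal_pos.2 ht)]
  congr 2
  ext ω
  exact (Real.toNNReal_lt_iff_lt_coe (le_of_lt ht)).symm

/-- The moments of order `p < 1` are homogeneous of degree `p` in the scale. -/
lemma HasFrechetLaw.lintegral_rpow_mul [IsProbabilityMeasure P] (h : HasFrechetLaw P Z v)
    (h' : HasFrechetLaw P Z' v') {p : ℝ} (hp : 0 < p) :
    (∫⁻ ω, (Z ω : ℝ≥0∞) ^ p ∂P) * (v' : ℝ≥0∞) ^ p =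
      (∫⁻ ω, (Z' ω : ℝ≥0∞) ^ p ∂P) * (v : ℝ≥0∞) ^ p := by
  have key {Z : Ω → ℝ≥0} (hZ : AEMeasurable Z P) (a : ℝ≥0) :
      (∫⁻ ω, (Z ω : ℝ≥0∞) ^ p ∂P) * (a : ℝ≥0∞) ^ p =
        ∫⁻ ω, ((a * Z ω : ℝ≥0) : ℝ≥0∞) ^ p ∂P := by
    rw [← lintegral_mul_const'' _ (hZ.coe_nnreal_ennreal.pow_const p)]
    refine lintegral_congr fun ω => ?_
    rw [ENNReal.coe_mul, ENNReal.mul_rpow_of_nonneg _ _ hp.le, mul_comm]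
  rw [key h.aemeasurable, key h'.aemeasurable, (h.const_mul v').lintegral_rpow hp,
    (h'.const_mul v).lintegral_rpow hp, mul_comm v' v]

lemma HasFrechetLaw.lintegral_rpow_lt_top [IsProbabilityMeasure P] (h : HasFrechetLaw P Z v)
    {p : ℝ} (hp : 0 < p) (hp1 : p < 1) : ∫⁻ ω, (Z ω : ℝ≥0∞) ^ p ∂P < ∞ := by
  rw [h.lintegral_rpow hp]
  refine ENNReal.mul_lt_top ENNReal.ofReal_lt_top ?_
  rw [← Ioc_union_Ioi_eq_Ioi (zero_le_one (α := ℝ)),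
    lintegral_union measurableSet_Ioi (Ioc_disjoint_Ioi le_rfl), ENNReal.add_lt_top]
  constructor
  · have h1 : IntegrableOn (fun t : ℝ => t ^ (p - 1)) (Ioc 0 1) :=
      (intervalIntegrable_iff_integrableOn_Ioc_of_le zero_le_one).1
        (intervalIntegral.intervalIntegrable_rpow' (by linarith))
    refine lt_of_le_of_lt (setLIntegral_mono' measurableSet_Ioc fun t ht => ?_)
      h1.lintegral_lt_top
    exact (mul_le_mul_left tsub_le_self _).trans_eq (one_mul _)
  · have h1 : IntegrableOn (fun t : ℝ => v * t ^ (p - 2)) (Ioi 1) :=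
      (integrableOn_Ioi_rpow_of_lt (by linarith) one_pos).const_mul _
    refine lt_of_le_of_lt (setLIntegral_mono' measurableSet_Ioi fun t ht => ?_)
      h1.lintegral_lt_top
    have ht0 : (0 : ℝ) < t := one_pos.trans ht
    refine (mul_le_mul_left (one_sub_expNeg_le _) _).trans_eq ?_
    rw [← ENNReal.ofReal_coe_nnreal, ← ENNReal.ofReal_mul (NNReal.coe_nonneg _), NNReal.coe_div,
      Real.coe_toNNReal _ ht0.le, show p - 2 = p - 1 - 1 by ring, Real.rpow_sub_one ht0.ne' (p - 1)]
    congr 1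
    ring

lemma HasFrechetLaw.ae_eq_zero (h : HasFrechetLaw P Z 0) [IsProbabilityMeasure P] :
    ∀ᵐ ω ∂P, Z ω = 0 := by
  have h1 (k : ℕ) : ∀ᵐ ω ∂P, Z ω ≤ 1 / ((k : ℝ≥0) + 1) := by
    refine (mem_ae_iff_prob_eq_one₀
      (nullMeasurableSet_le h.aemeasurable aemeasurable_const)).2 ?_
    rw [h.cdf _ (by positivity), zero_div, ENNReal.coe_zero, expNeg_zero]
  filter_upwards [ae_all_iff.2 h1] with ω h2
  exact le_antisymm (ge_of_tendsto' tendsto_one_div_add_atTop_nhds_zero_nat h2) zero_le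

lemma hasFrechetLaw_zero [IsProbabilityMeasure P] : HasFrechetLaw P (fun _ : Ω => 0) 0 where
  aemeasurable := aemeasurable_const
  cdf y hy := by simp [expNeg_zero]

lemma HasFrechetLaw.lintegral_rpow_ne_zero [IsProbabilityMeasure P] (h : HasFrechetLaw P Z v)
    {p : ℝ} (hp : 0 < p) (hv : v ≠ 0) : ∫⁻ ω, (Z ω : ℝ≥0∞) ^ p ∂P ≠ 0 := by
  rw [Ne, lintegral_eq_zero_iff' (h.aemeasurable.coe_nnreal_ennreal.pow_const p)]
  intro h0
  refine hv (h.unique (hasFrechetLaw_zero.congr ?_))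
  filter_upwards [h0] with ω hω
  have : Z ω = 0 := by simpa [ENNReal.rpow_eq_zero_iff, hp, hp.le] using hω
  exact this.symm

lemma HasFrechetLaw.ae_ne_one [IsProbabilityMeasure P] (h : HasFrechetLaw P Z v) :
    ∀ᵐ ω ∂P, Z ω ≠ 1 := by
  have h1 (k : ℕ) : P {ω | Z ω = 1} + expNeg (v * (1 + 1 / ((k : ℝ≥0) + 1)) : ℝ≥0) ≤
      expNeg v := by
    have hlt : 1 / (1 + 1 / ((k : ℝ≥0) + 1)) < 1 := by
      rw [div_lt_one (by positivity)]
      exact lt_add_of_pos_right _ (by positivity)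
    have h2 := h.cdf (1 / (1 + 1 / ((k : ℝ≥0) + 1))) (by positivity)
    have h3 := h.cdf 1 one_pos
    rw [div_one] at h3
    rw [div_div_eq_mul_div, div_one] at h2
    rw [← h2, ← h3, ← measure_union₀
      (nullMeasurableSet_le h.aemeasurable aemeasurable_const)]
    · refine measure_mono (union_subset (fun ω hω => le_of_eq hω) fun ω hω => ?_)
      exact le_trans (show Z ω ≤ _ from hω) hlt.le
    · refine Disjoint.aedisjoint (disjoint_left.2 fun ω (hω : Z ω = 1) (hω' : Z ω ≤ _) => ?_)
      exact not_le.2 hlt (hω ▸ hω')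
  have h2 : Tendsto (fun k : ℕ => P {ω | Z ω = 1} +
      expNeg (v * (1 + 1 / ((k : ℝ≥0) + 1)) : ℝ≥0)) atTop (𝓝 (P {ω | Z ω = 1} + expNeg v)) := by
    refine tendsto_const_nhds.add ((continuous_expNeg.tendsto _).comp (ENNReal.tendsto_coe.2 ?_))
    simpa using ((tendsto_one_div_add_atTop_nhds_zero_nat (𝕜 := ℝ≥0)).const_add 1).const_mul v
  have h3 : P {ω | Z ω = 1} + expNeg v ≤ 0 + expNeg v := by
    rw [zero_add]; exact le_of_tendsto' h2 h1
  have h4 : expNeg v ≠ ∞ := by rw [expNeg_coe]; exact ENNReal.ofReal_ne_top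
  have h5 := (ENNReal.add_le_add_iff_right h4).1 h3
  rw [ae_iff]
  simpa using h5

/-- The scale is a continuous function of the random variable. -/
lemma HasFrechetLaw.tendsto_scale [IsProbabilityMeasure P] {κ : Type*} {l : Filter κ}
    [l.IsCountablyGenerated] {Zn : κ → Ω → ℝ≥0} {vn : κ → ℝ≥0}
    (hn : ∀ n, HasFrechetLaw P (Zn n) (vn n)) (h : HasFrechetLaw P Z v)
    (hlim : ∀ᵐ ω ∂P, Tendsto (fun n => Zn n ω) l (𝓝 (Z ω))) : Tendsto vn l (𝓝 v) := by
  have hreal {Z : Ω → ℝ≥0} {v : ℝ≥0} (h : HasFrechetLaw P Z v) :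
      ∫ ω, {ω | Z ω ≤ 1}.indicator (fun _ => (1 : ℝ)) ω ∂P = Real.exp (-v) := by
    rw [integral_indicator₀ (nullMeasurableSet_le h.aemeasurable aemeasurable_const)]
    simp only [integral_const, smul_eq_mul, mul_one, measureReal_restrict_apply_univ]
    rw [measureReal_def, h.cdf 1 one_pos, div_one, expNeg_coe,
      ENNReal.toReal_ofReal (Real.exp_pos _).le]
  have h1 : Tendsto (fun n => Real.exp (-(vn n : ℝ))) l (𝓝 (Real.exp (-v))) := by
    simp_rw [← hreal (hn _), ← hreal h]
    refine tendsto_integral_filter_of_dominated_convergence (fun _ => 1)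
      (Eventually.of_forall fun n => aestronglyMeasurable_const.indicator₀
        (nullMeasurableSet_le (hn n).aemeasurable aemeasurable_const))
      (Eventually.of_forall fun n => Eventually.of_forall fun ω => ?_) (integrable_const _) ?_
    · by_cases hω : ω ∈ {ω | Zn n ω ≤ 1} <;> simp [hω]
    · filter_upwards [hlim, h.ae_ne_one] with ω hω hne
      rcases lt_or_gt_of_ne hne with h1 | h1
      · refine tendsto_const_nhds.congr' ?_
        filter_upwards [hω.eventually (gt_mem_nhds h1)] with n hn
        rw [indicator_of_mem (show ω ∈ {ω | Z ω ≤ 1} from h1.le),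
          indicator_of_mem (show ω ∈ {ω | Zn n ω ≤ 1} from le_of_lt hn)]
      · refine tendsto_const_nhds.congr' ?_
        filter_upwards [hω.eventually (lt_mem_nhds h1)] with n hn
        rw [indicator_of_notMem (show ω ∉ {ω | Z ω ≤ 1} from not_le.2 h1),
          indicator_of_notMem (show ω ∉ {ω | Zn n ω ≤ 1} from not_le.2 hn)]
  have h2 := (h1.log (Real.exp_pos _).ne').neg
  simp only [Real.log_exp, neg_neg] at h2
  exact NNReal.tendsto_coe.1 h2

end Law

/-! ### Dominating random variable -/

section Dominating

variable {ι Ω : Type*} [Countable ι] [MeasurableSpace Ω] {P : Measure Ω} [IsProbabilityMeasure P]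
  {U : ι → Ω → ℝ≥0} {V : Finset ι → (ι → ℝ≥0) → ℝ≥0}

/-- Countably many Fréchet variables have a Fréchet supremum after a suitable scaling. -/
lemma exists_dominating
    (hV : ∀ J w, HasFrechetLaw P (fun ω => J.sup fun i => w i * U i ω) (V J w)) :
    ∃ (c : ι → ℝ≥0) (Z : Ω → ℝ≥0) (v : ℝ≥0), (∀ i, 0 < c i) ∧ HasFrechetLaw P Z v ∧
      (∀ᵐ ω ∂P, ∀ i, c i * U i ω ≤ Z ω) ∧ Tendsto (fun J => V J c) atTop (𝓝 v) := by
  obtain ⟨ε, hε, s, hs, hs2⟩ := NNReal.exists_pos_sum_of_countable (one_half_pos (α := ℝ≥0)).ne' ι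
  have hσ (i : ι) : HasFrechetLaw P (U i) (V {i} 1) := by simpa using hV {i} 1
  obtain ⟨c, hc⟩ : ∃ c : ι → ℝ≥0, ∀ i, c i = ε i / (1 + V {i} 1) := ⟨_, fun i => rfl⟩
  have hc0 (i : ι) : 0 < c i := by rw [hc]; exact div_pos (hε i) (by positivity)
  have hcσ (i : ι) : c i * V {i} 1 ≤ ε i := by
    rw [hc, div_mul_eq_mul_div, div_le_iff₀ (by positivity)]
    exact mul_le_mul_right (le_add_of_nonneg_left zero_le_one) _
  have hmono : Monotone fun J => V J c := fun J J' hJ =>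
    (hV J c).mono (hV J' c) (Eventually.of_forall fun ω => Finset.sup_mono hJ)
  -- the scales stay bounded, since `P (sup ≤ 1)` stays above `1 / 2`
  have hhalf (J : Finset ι) : (1 / 2 : ℝ≥0) ≤ expNeg (V J c) := by
    have h1 := (hV J c).cdf 1 one_pos
    rw [div_one] at h1
    have h2 : P {ω | 1 < J.sup fun i => c i * U i ω} ≤ (1 / 2 : ℝ≥0) := by
      have h3 : {ω | 1 < J.sup fun i => c i * U i ω} = ⋃ i ∈ J, {ω | 1 < c i * U i ω} := by
        ext ω; simp [Finset.lt_sup_iff]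
      rw [h3]
      refine (measure_biUnion_finset_le J _).trans ?_
      refine (Finset.sum_le_sum fun i _ => (((hσ i).const_mul (c i)).measure_gt_le one_pos).trans
        (ENNReal.coe_le_coe.2 ((div_one _).trans_le (hcσ i)))).trans ?_
      rw [← ENNReal.ofNNReal_finsetSum, ENNReal.coe_le_coe]
      exact (hs.summable.sum_le_tsum J fun _ _ => zero_le).trans (hs.tsum_eq.trans_le hs2.le)
    have h4 := (hV J c).measure_gt one_pos
    rw [h4, div_one, tsub_le_iff_right] at h2
    have h5 : (1 / 2 : ℝ≥0) + (1 / 2 : ℝ≥0) ≤ (1 / 2 : ℝ≥0) + expNeg (V J c) := by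
      refine le_trans (le_of_eq ?_) h2
      rw [← ENNReal.coe_add, add_halves, ENNReal.coe_one]
    exact (ENNReal.add_le_add_iff_left ENNReal.coe_ne_top).1 h5
  have hbdd : BddAbove (range fun J => V J c) := by
    refine ⟨1, ?_⟩
    rintro _ ⟨J, rfl⟩
    by_contra! h
    have h1 := expNeg_strictAnti (ENNReal.coe_lt_coe.2 h)
    have h2 := (hhalf J).trans_lt h1
    rw [expNeg_coe, ← ENNReal.ofReal_coe_nnreal,
      ENNReal.ofReal_lt_ofReal_iff (Real.exp_pos _)] at h2
    have h3 : Real.exp (-1) < 1 / 2 := by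
      have := Real.exp_one_gt_d9
      rw [Real.exp_neg, one_div]
      exact inv_strictAnti₀ two_pos (by linarith)
    norm_num at h2
    norm_num at h3
    linarith
  have hlim := tendsto_atTop_ciSup hmono hbdd
  set v := ⨆ J, V J c with hv
  obtain ⟨W, hW⟩ : ∃ W : Ω → ℝ≥0∞, ∀ ω, W ω = ⨆ i, ((c i * U i ω : ℝ≥0) : ℝ≥0∞) :=
    ⟨_, fun ω => rfl⟩
  have hcdf (y : ℝ≥0) (hy : 0 < y) : P {ω | W ω ≤ y} = expNeg (v / y : ℝ≥0) := by
    have h1 : {ω | W ω ≤ y} = ⋂ J : Finset ι, {ω | (J.sup fun i => c i * U i ω) ≤ y} := by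
      ext ω
      simp only [hW, mem_ofPred_eq, iSup_le_iff, ENNReal.coe_le_coe, mem_iInter, Finset.sup_le_iff]
      exact ⟨fun h J i _ => h i, fun h i => h {i} i (Finset.mem_singleton_self i)⟩
    rw [h1]
    have h2 : Tendsto (fun J : Finset ι => P {ω | (J.sup fun i => c i * U i ω) ≤ y}) atTop
        (𝓝 (P (⋂ J : Finset ι, {ω | (J.sup fun i => c i * U i ω) ≤ y}))) := by
      refine tendsto_measure_iInter_atTop (fun J =>
        nullMeasurableSet_le (hV J c).aemeasurable aemeasurable_const) ?_
        ⟨∅, measure_ne_top _ _⟩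
      exact fun J J' hJ ω (hω : _ ≤ y) => (Finset.sup_mono hJ).trans hω
    refine tendsto_nhds_unique h2 ?_
    simp_rw [(hV _ c).cdf y hy]
    refine (continuous_expNeg.tendsto _).comp (ENNReal.tendsto_coe.2 ?_)
    exact hlim.div_const y
  have hWm : AEMeasurable W P := by
    have : W = fun ω => ⨆ i, ((c i * U i ω : ℝ≥0) : ℝ≥0∞) := funext hW
    rw [this]
    exact AEMeasurable.iSup fun i => ((hσ i).aemeasurable.const_mul _).coe_nnreal_ennreal
  have hfin : ∀ᵐ ω ∂P, W ω < ∞ := by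
    refine (mem_ae_iff_prob_eq_one₀ (nullMeasurableSet_lt hWm aemeasurable_const)).2 ?_
    have h1 : Tendsto (fun n : ℕ => expNeg (v / ((n : ℝ≥0) + 1) : ℝ≥0)) atTop (𝓝 1) := by
      rw [← expNeg_zero]
      refine (continuous_expNeg.tendsto _).comp ?_
      rw [← ENNReal.coe_zero, ENNReal.tendsto_coe]
      have := (tendsto_one_div_add_atTop_nhds_zero_nat (𝕜 := ℝ≥0)).const_mul v
      simpa [div_eq_mul_inv] using this
    refine le_antisymm prob_le_one (le_of_tendsto' h1 fun n => ?_)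
    rw [← hcdf _ (by positivity)]
    exact measure_mono fun ω hω => lt_of_le_of_lt hω ENNReal.coe_lt_top
  refine ⟨c, fun ω => (W ω).toNNReal, v, hc0, ⟨hWm.ennreal_toNNReal, fun y hy => ?_⟩, ?_, hlim⟩
  · rw [← hcdf y hy]
    refine measure_congr (hfin.mono fun ω hω => ?_)
    apply propext
    change (W ω).toNNReal ≤ y ↔ W ω ≤ y
    rw [← ENNReal.coe_le_coe, ENNReal.coe_toNNReal hω.ne]
  · filter_upwards [hfin] with ω hω i
    rw [← ENNReal.coe_le_coe, ENNReal.coe_toNNReal hω.ne, hW]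
    exact le_iSup (fun i => ((c i * U i ω : ℝ≥0) : ℝ≥0∞)) i

end Dominating

/-! ### The spectral measure of a countable family -/

lemma rpow_le_add_one_sub {x p : ℝ} (hx : 0 ≤ x) (hp0 : 0 ≤ p) (hp1 : p ≤ 1) :
    x ^ p ≤ x + (1 - p) := by
  have h := Real.geom_mean_le_arith_mean2_weighted hp0 (sub_nonneg.2 hp1) hx zero_le_one
    (by ring)
  rw [Real.one_rpow, mul_one, mul_one] at h
  nlinarith

lemma le_rpow_add_mul_sq {x p : ℝ} (hx : 0 ≤ x) (hp0 : 0 < p) (hp1 : p ≤ 1) :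
    x ≤ x ^ p + (1 - p) * x ^ 2 := by
  rcases hx.eq_or_lt with rfl | hx
  · simp [Real.zero_rpow hp0.ne']
  have h1 : x ^ p = x * Real.exp ((p - 1) * Real.log x) := by
    nth_rewrite 2 [← Real.exp_log hx]
    rw [← Real.exp_add, Real.rpow_def_of_pos hx]
    congr 1; ring
  have h2 := Real.add_one_le_exp ((p - 1) * Real.log x)
  have h3 := Real.log_le_self hx.le
  have h4 : (p - 1) * x ≤ (p - 1) * Real.log x := mul_le_mul_of_nonpos_left h3 (by linarith)
  rw [h1]
  nlinarith

/-- The power `x ^ p` tends to `x` as `p → 1`, uniformly for `x` in a bounded set. -/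
lemma nnreal_rpow_near_self {x C : ℝ≥0} (hx : x ≤ C) {p : ℝ} (hp0 : 0 < p) (hp1 : p ≤ 1) :
    x ^ p ≤ x + (1 - p).toNNReal ∧ x ≤ x ^ p + (1 - p).toNNReal * C ^ 2 := by
  have h0 : ((1 - p).toNNReal : ℝ) = 1 - p := Real.coe_toNNReal _ (by linarith)
  constructor
  · rw [← NNReal.coe_le_coe]
    push_cast
    rw [h0]
    exact rpow_le_add_one_sub x.2 hp0.le hp1
  · refine le_trans ?_ (add_le_add_right (mul_le_mul_right (pow_le_pow_left₀ zero_le hx 2) _) _)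
    rw [← NNReal.coe_le_coe]
    push_cast
    rw [h0]
    exact le_rpow_add_mul_sq x.2 hp0 hp1

lemma continuous_sup_coord {ι : Type*} (J : Finset ι) (a : ι → ℝ≥0) :
    Continuous fun k : ι → Icc (0 : ℝ≥0) 1 => J.sup fun i => a i * (k i : ℝ≥0) :=
  Continuous.finset_sup_apply fun i _ => by fun_prop

/-- The law of `κ` under the probability measure with density proportional to `Z ^ p`. -/
lemma exists_tilted_law {Ω K : Type*} [MeasurableSpace Ω] [MeasurableSpace K] {P : Measure Ω}
    {κ : Ω → K} (hκ : AEMeasurable κ P) {Z : Ω → ℝ≥0} (hZ : AEMeasurable Z P) {p : ℝ}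
    (h0 : ∫⁻ ω, (Z ω : ℝ≥0∞) ^ p ∂P ≠ 0)
    (h1 : ∫⁻ ω, (Z ω : ℝ≥0∞) ^ p ∂P ≠ ∞) : ∃ Q : ProbabilityMeasure K, ∀ F : K → ℝ≥0∞,
      Measurable F → (∫⁻ k, F k ∂Q) * ∫⁻ ω, (Z ω : ℝ≥0∞) ^ p ∂P =
        ∫⁻ ω, (Z ω : ℝ≥0∞) ^ p * F (κ ω) ∂P := by
  set M := ∫⁻ ω, (Z ω : ℝ≥0∞) ^ p ∂P with hM
  have hZp : AEMeasurable (fun ω => (Z ω : ℝ≥0∞) ^ p) P := hZ.coe_nnreal_ennreal.pow_const p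
  have hκ' : AEMeasurable κ (P.withDensity fun ω => (Z ω : ℝ≥0∞) ^ p) :=
    hκ.mono_ac (withDensity_absolutelyContinuous _ _)
  have key (F : K → ℝ≥0∞) (hF : Measurable F) :
      ∫⁻ k, F k ∂(M⁻¹ • (P.withDensity fun ω => (Z ω : ℝ≥0∞) ^ p).map κ) =
        M⁻¹ * ∫⁻ ω, (Z ω : ℝ≥0∞) ^ p * F (κ ω) ∂P := by
    rw [lintegral_smul_measure, lintegral_map' hF.aemeasurable hκ',
      lintegral_withDensity_eq_lintegral_mul₀ (g := fun ω => F (κ ω)) hZp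
        (hF.comp_aemeasurable hκ), smul_eq_mul]
    rfl
  refine ⟨⟨M⁻¹ • (P.withDensity fun ω => (Z ω : ℝ≥0∞) ^ p).map κ, ⟨?_⟩⟩, fun F hF => ?_⟩
  · have := key (fun _ => 1) measurable_const
    simp only [mul_one, lintegral_const, one_mul] at this
    rw [this, ENNReal.inv_mul_cancel h0 h1]
  · change (∫⁻ k, F k ∂(M⁻¹ • (P.withDensity fun ω => (Z ω : ℝ≥0∞) ^ p).map κ)) * M = _
    rw [key F hF, mul_comm, ← mul_assoc, ENNReal.mul_inv_cancel h0 h1, one_mul]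

section Spectral

variable {ι Ω : Type*} [Countable ι] [MeasurableSpace Ω] {P : Measure Ω} [IsProbabilityMeasure P]
  {U : ι → Ω → ℝ≥0} {V : Finset ι → (ι → ℝ≥0) → ℝ≥0}

/-- The spectral measure of a countable max-stable family: with `κ i = c i * U i / Z`, where `Z`
dominates all `c i * U i`, it is the limit, as `p → 1`, of the laws of `κ` under the probability
measures with density proportional to `Z ^ p`. -/
theorem exists_spectralMeasure
    (hV : ∀ J w, HasFrechetLaw P (fun ω => J.sup fun i => w i * U i ω) (V J w)) :
    ∃ (c : ι → ℝ≥0) (Q : Measure (ι → Icc (0 : ℝ≥0) 1)), IsFiniteMeasure Q ∧ (∀ i, 0 < c i) ∧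
      (∀ J w, ∫⁻ k, ((J.sup fun i => w i * ((k i : ℝ≥0) / c i) : ℝ≥0) : ℝ≥0∞) ∂Q = V J w) ∧
      Tendsto (fun J => (V J c : ℝ≥0∞)) atTop (𝓝 (Q univ)) := by
  obtain ⟨c, Z, v, hc, hZ, hdom, hlim⟩ := exists_dominating hV
  have hU (i : ι) : AEMeasurable (U i) P := by
    have := (hV {i} 1).aemeasurable
    simpa using this
  rcases eq_or_ne v 0 with rfl | hv
  · refine ⟨c, 0, inferInstance, hc, fun J w => ?_, ?_⟩
    · have h0 : (fun _ => (0 : ℝ≥0)) =ᵐ[P] fun ω => J.sup fun i => w i * U i ω := by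
        filter_upwards [hZ.ae_eq_zero, hdom] with ω h1 h2
        refine (le_antisymm (Finset.sup_le fun i _ => ?_) zero_le).symm
        have h3 := h2 i
        rw [h1] at h3
        have h4 := (mul_eq_zero.1 (le_antisymm h3 zero_le)).resolve_left (hc i).ne'
        rw [h4, mul_zero]
      rw [(hV J w).unique (hasFrechetLaw_zero.congr h0)]
      simp
    · rw [Measure.coe_zero, Pi.zero_apply, ← ENNReal.coe_zero, ENNReal.tendsto_coe]
      exact hlim
  obtain ⟨κ, hκ⟩ : ∃ κ : Ω → ι → Icc (0 : ℝ≥0) 1,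
      ∀ ω i, (κ ω i : ℝ≥0) = min (c i * U i ω / Z ω) 1 :=
    ⟨fun ω i => ⟨min (c i * U i ω / Z ω) 1, zero_le, min_le_right _ _⟩, fun _ _ => rfl⟩
  have hκm : AEMeasurable κ P := by
    refine aemeasurable_pi_iff.2 fun i => ?_
    have h1 : AEMeasurable (fun ω => (κ ω i : ℝ≥0)) P := by
      simp_rw [hκ]
      exact (((hU i).const_mul _).div hZ.aemeasurable).min aemeasurable_const
    exact h1.subtype_mk
  -- the max-linear combinations of the `U i` are functions of `κ`, times `Z`
  have hfactor (J : Finset ι) (w : ι → ℝ≥0) : ∀ᵐ ω ∂P, (J.sup fun i => w i * U i ω) =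
      Z ω * J.sup fun i => (w i / c i) * (κ ω i : ℝ≥0) := by
    filter_upwards [hdom] with ω hω
    rw [NNReal.mul_finset_sup]
    refine Finset.sup_congr rfl fun i _ => ?_
    rw [hκ]
    rcases eq_or_ne (Z ω) 0 with h0 | h0
    · have h1 := hω i
      rw [h0] at h1
      have h4 := (mul_eq_zero.1 (le_antisymm h1 zero_le)).resolve_left (hc i).ne'
      rw [h0, h4]; simp
    · rw [min_eq_left (div_le_one_of_le₀ (hω i) zero_le)]
      have := (hc i).ne'
      field_simp
  set p : ℕ → ℝ := fun n => 1 - 1 / ((n : ℝ) + 2) with hp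
  have hp0 (n : ℕ) : 0 < p n := by
    rw [hp, sub_pos, div_lt_one (by positivity)]
    have : (0 : ℝ) ≤ n := n.cast_nonneg
    linarith
  have hp1 (n : ℕ) : p n < 1 := sub_lt_self _ (by positivity)
  have hplim : Tendsto p atTop (𝓝 1) := by
    have h1 : Tendsto (fun n : ℕ => 1 / ((n : ℝ) + 2)) atTop (𝓝 0) := by
      refine tendsto_const_nhds.div_atTop ?_
      exact tendsto_atTop_add_const_right _ _ tendsto_natCast_atTop_atTop
    simpa [hp] using h1.const_sub 1
  choose Qn hQn using fun n => exists_tilted_law hκm hZ.aemeasurable (p := p n)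
    (hZ.lintegral_rpow_ne_zero (hp0 n) hv) (hZ.lintegral_rpow_lt_top (hp0 n) (hp1 n)).ne
  -- a cluster point, by compactness of the space of probability measures
  obtain ⟨Q, hQ⟩ : ∃ Q : ProbabilityMeasure (ι → Icc (0 : ℝ≥0) 1),
      Tendsto Qn (hyperfilter ℕ) (𝓝 Q) :=
    ⟨_, ((hyperfilter ℕ).map Qn).le_nhds_lim⟩
  have hmain (J : Finset ι) (w : ι → ℝ≥0) :
      ∫⁻ k : ι → Icc (0 : ℝ≥0) 1, ((J.sup fun i => (w i / c i) * (k i : ℝ≥0) : ℝ≥0) : ℝ≥0∞)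
        ∂(Q : Measure (ι → Icc (0 : ℝ≥0) 1)) =
        ((V J w / v : ℝ≥0) : ℝ≥0∞) := by
    set W : (ι → Icc (0 : ℝ≥0) 1) → ℝ≥0 := fun k => J.sup fun i => (w i / c i) * (k i : ℝ≥0)
      with hW
    have hWc : Continuous W := continuous_sup_coord J _
    set C : ℝ≥0 := J.sup fun i => w i / c i with hC
    have hWC (k) : W k ≤ C :=
      Finset.sup_mono_fun fun i _ => mul_le_of_le_one_right zero_le (k i).2.2
    have hpow (n : ℕ) : ∫⁻ k, ((W k ^ p n : ℝ≥0) : ℝ≥0∞) ∂(Qn n) =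
        ((V J w / v) ^ p n : ℝ≥0) := by
      have h1 := hQn n (fun k => ((W k ^ p n : ℝ≥0) : ℝ≥0∞))
        ((hWc.measurable.pow_const _).coe_nnreal_ennreal)
      have h2 : ∫⁻ ω, (Z ω : ℝ≥0∞) ^ p n * ((W (κ ω) ^ p n : ℝ≥0) : ℝ≥0∞) ∂P =
          ∫⁻ ω, ((J.sup fun i => w i * U i ω : ℝ≥0) : ℝ≥0∞) ^ p n ∂P := by
        refine lintegral_congr_ae ((hfactor J w).mono fun ω hω => ?_)
        beta_reduce
        rw [hω, ENNReal.coe_mul, ENNReal.mul_rpow_of_nonneg _ _ (hp0 n).le,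
          ENNReal.coe_rpow_of_nonneg _ (hp0 n).le]
      have h3 := (hV J w).lintegral_rpow_mul hZ (hp0 n)
      have hM0 := hZ.lintegral_rpow_ne_zero (hp0 n) hv
      have hM1 := (hZ.lintegral_rpow_lt_top (hp0 n) (hp1 n)).ne
      have hv0 : (v : ℝ≥0∞) ^ p n ≠ 0 := by simp [ENNReal.rpow_eq_zero_iff, hv]
      have hv1 : (v : ℝ≥0∞) ^ p n ≠ ∞ :=
        ENNReal.rpow_ne_top_of_nonneg (hp0 n).le ENNReal.coe_ne_top
      rw [h2] at h1
      rw [← h1, mul_comm _ (∫⁻ ω, (Z ω : ℝ≥0∞) ^ p n ∂P), mul_assoc,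
        ENNReal.mul_right_inj hM0 hM1] at h3
      rw [NNReal.div_rpow, ENNReal.coe_div (NNReal.rpow_pos (pos_iff_ne_zero.2 hv)).ne',
        ENNReal.coe_rpow_of_nonneg _ (hp0 n).le, ENNReal.coe_rpow_of_nonneg _ (hp0 n).le,
        ENNReal.eq_div_iff hv0 hv1, mul_comm]
      exact h3
    have hlimpow : Tendsto (fun n => (((V J w / v) ^ p n : ℝ≥0) : ℝ≥0∞)) (hyperfilter ℕ)
        (𝓝 ((V J w / v : ℝ≥0) : ℝ≥0∞)) := by
      refine ENNReal.tendsto_coe.2 (NNReal.tendsto_coe.1 ?_)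
      simp_rw [NNReal.coe_rpow]
      have h1 := ((Real.continuousAt_const_rpow' (a := ((V J w / v : ℝ≥0) : ℝ))
        one_ne_zero).tendsto.comp hplim).mono_left Nat.hyperfilter_le_atTop
      simpa [Function.comp_def] using h1
    have hlimW : Tendsto (fun n => ∫⁻ k, (W k : ℝ≥0∞) ∂(Qn n)) (hyperfilter ℕ)
        (𝓝 (∫⁻ k, (W k : ℝ≥0∞) ∂Q)) :=
      (ProbabilityMeasure.tendsto_iff_forall_lintegral_tendsto.1 hQ)
        (BoundedContinuousFunction.mkOfCompact ⟨W, hWc⟩)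
    have herr (C : ℝ≥0) : Tendsto (fun n => (((1 - p n).toNNReal * C : ℝ≥0) : ℝ≥0∞))
        (hyperfilter ℕ) (𝓝 0) := by
      rw [← ENNReal.coe_zero, ENNReal.tendsto_coe]
      have h1 := (tendsto_real_toNNReal (hplim.const_sub 1)).mul_const C
      rw [sub_self, Real.toNNReal_zero, zero_mul] at h1
      exact h1.mono_left Nat.hyperfilter_le_atTop
    refine le_antisymm ?_ ?_
    · refine le_of_tendsto_of_tendsto' hlimW
        (by simpa only [add_zero] using hlimpow.add (herr (C ^ 2))) fun n => ?_
      rw [← hpow n]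
      have h1 : ∫⁻ k, (W k : ℝ≥0∞) ∂(Qn n) ≤
          ∫⁻ k, (((W k ^ p n : ℝ≥0) : ℝ≥0∞) + ((1 - p n).toNNReal * C ^ 2 : ℝ≥0)) ∂(Qn n) := by
        refine lintegral_mono fun k => ?_
        rw [← ENNReal.coe_add, ENNReal.coe_le_coe]
        exact (nnreal_rpow_near_self (hWC k) (hp0 n) (hp1 n).le).2
      rwa [lintegral_add_right _ measurable_const, lintegral_const, measure_univ, mul_one] at h1
    · refine le_of_tendsto_of_tendsto' hlimpow
        (by simpa only [add_zero] using hlimW.add (herr 1)) fun n => ?_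
      rw [← hpow n]
      have h1 : ∫⁻ k, ((W k ^ p n : ℝ≥0) : ℝ≥0∞) ∂(Qn n) ≤
          ∫⁻ k, ((W k : ℝ≥0∞) + ((1 - p n).toNNReal * 1 : ℝ≥0)) ∂(Qn n) := by
        refine lintegral_mono fun k => ?_
        rw [← ENNReal.coe_add, ENNReal.coe_le_coe, mul_one]
        exact (nnreal_rpow_near_self (hWC k) (hp0 n) (hp1 n).le).1
      rwa [lintegral_add_right _ measurable_const, lintegral_const, measure_univ, mul_one] at h1
  refine ⟨c, v • (Q : Measure (ι → Icc (0 : ℝ≥0) 1)), inferInstance, hc, fun J w => ?_, ?_⟩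
  · have h1 := hmain J w
    rw [lintegral_smul_measure]
    have h2 (k : ι → Icc (0 : ℝ≥0) 1) : (J.sup fun i => w i * ((k i : ℝ≥0) / c i)) =
        J.sup fun i => (w i / c i) * (k i : ℝ≥0) :=
      Finset.sup_congr rfl fun i _ => by rw [mul_div_assoc', div_mul_eq_mul_div]
    simp_rw [h2]
    rw [h1, ENNReal.smul_def, smul_eq_mul, ← ENNReal.coe_mul, mul_div_cancel₀ _ hv]
  · have : (v • (Q : Measure (ι → Icc (0 : ℝ≥0) 1))) univ = v := by
      rw [Measure.smul_apply, measure_univ, ENNReal.smul_def, smul_eq_mul, mul_one]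
    rw [this, ENNReal.tendsto_coe]
    exact hlim

end Spectral

/-! ### Limits of spectral functions -/

/-- Completeness of `L¹`, for functions with values in `[0, ∞)`. -/
lemma exists_lintegral_edist_limit {K : Type*} [MeasurableSpace K] {Q : Measure K}
    {g : ℕ → K → ℝ≥0} (hg : ∀ n, Measurable (g n)) (hint : ∀ n, ∫⁻ k, g n k ∂Q < ∞)
    (hc : Tendsto (fun n : ℕ × ℕ => ∫⁻ k, edist (g n.1 k) (g n.2 k) ∂Q) atTop (𝓝 0)) :
    ∃ G : K → ℝ≥0, Measurable G ∧
      Tendsto (fun n => ∫⁻ k, edist (g n k) (G k) ∂Q) atTop (𝓝 0) := by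
  have hmem (n : ℕ) : MemLp (fun k => (g n k : ℝ)) 1 Q := by
    refine memLp_one_iff_integrable.2 ⟨(hg n).coe_nnreal_real.aestronglyMeasurable, ?_⟩
    rw [hasFiniteIntegral_iff_enorm]
    simpa using hint n
  have hcauchy : CauchySeq fun n => (hmem n).toLp _ := by
    rw [cauchySeq_iff_tendsto_dist_atTop_0]
    have h1 (n : ℕ × ℕ) : dist ((hmem n.1).toLp _) ((hmem n.2).toLp _) =
        (∫⁻ k, edist (g n.1 k) (g n.2 k) ∂Q).toReal := by
      rw [dist_edist, Lp.edist_toLp_toLp, eLpNorm_one_eq_lintegral_enorm]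
      congr 2
    simp_rw [h1]
    simpa [Function.comp_def] using (ENNReal.tendsto_toReal ENNReal.zero_ne_top).comp hc
  obtain ⟨G, hG⟩ := cauchySeq_tendsto_of_complete hcauchy
  obtain ⟨G', hG'm, hG'⟩ := (Lp.aestronglyMeasurable G).aemeasurable
  refine ⟨fun k => (G' k).toNNReal, hG'm.real_toNNReal, ?_⟩
  have h2 : Tendsto (fun n => edist ((hmem n).toLp _) G) atTop (𝓝 0) :=
    tendsto_iff_edist_tendsto_0.1 hG
  refine tendsto_of_tendsto_of_tendsto_of_le_of_le tendsto_const_nhds h2 (fun _ => zero_le)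
    fun n => ?_
  change _ ≤ edist ((hmem n).toLp _) G
  rw [Lp.edist_def, eLpNorm_one_eq_lintegral_enorm]
  refine lintegral_mono_ae ?_
  filter_upwards [(hmem n).coeFn_toLp, hG'] with k hk hk'
  rw [Pi.sub_apply, hk, hk', ← edist_eq_enorm_sub]
  have h3 : edist (g n k) (G' k).toNNReal = edist ((g n k : ℝ).toNNReal) (G' k).toNNReal := by
    rw [Real.toNNReal_coe]
  rw [h3]
  have := Real.lipschitzWith_toNNReal.edist_le_mul (g n k : ℝ) (G' k)
  simpa using this

lemma edist_add_add_eq (a b : ℝ≥0) : edist a b + (a + b) = 2 * (max a b : ℝ≥0) := by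
  wlog h : b ≤ a generalizing a b
  · rw [edist_comm, add_comm (a : ℝ≥0∞), max_comm]
    exact this b a (le_of_not_ge h)
  have h1 : edist a b = ((a - b : ℝ≥0) : ℝ≥0∞) := by
    rw [edist_nndist, NNReal.nndist_eq, max_eq_left]
    rw [tsub_eq_zero_of_le h]; exact zero_le
  rw [h1, max_eq_left h, ← ENNReal.coe_add, ← ENNReal.coe_add, ← ENNReal.coe_two,
    ← ENNReal.coe_mul, ENNReal.coe_inj, add_comm a b, ← add_assoc, tsub_add_cancel_of_le h, two_mul]

lemma le_add_edist (a b : ℝ≥0) : (a : ℝ≥0∞) ≤ b + edist a b := by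
  have := edist_triangle (a : ℝ≥0) b 0
  rw [edist_comm a 0, edist_comm b 0, add_comm] at this
  simpa [edist_nndist, NNReal.nndist_eq] using this

lemma edist_max_le (a b a' b' : ℝ≥0) :
    edist (max a b) (max a' b') ≤ edist a a' + edist b b' := by
  have h : nndist (max a b) (max a' b') ≤ nndist a a' + nndist b b' := by
    rw [← NNReal.coe_le_coe, NNReal.coe_add, coe_nndist, coe_nndist, coe_nndist, NNReal.dist_eq,
      NNReal.dist_eq, NNReal.dist_eq, NNReal.coe_max, NNReal.coe_max]
    refine (abs_max_sub_max_le_max _ _ _ _).trans (max_le ?_ ?_)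
    · linarith [abs_nonneg ((b : ℝ) - b')]
    · linarith [abs_nonneg ((a : ℝ) - a')]
  simp only [edist_nndist]
  exact_mod_cast h

lemma edist_finset_sup_le {ι : Type*} (J : Finset ι) (a b : ι → ℝ≥0) :
    edist (J.sup a) (J.sup b) ≤ ∑ i ∈ J, edist (a i) (b i) := by
  classical
  induction J using Finset.induction_on with
  | empty => simp
  | insert i s hi ih =>
    rw [Finset.sup_insert, Finset.sup_insert, Finset.sum_insert hi]
    exact (edist_max_le _ _ _ _).trans (by gcongr)

lemma edist_mul_left_nnreal (w a b : ℝ≥0) : edist (w * a) (w * b) = w * edist a b := by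
  simp only [edist_nndist]
  rw [← ENNReal.coe_mul, ENNReal.coe_inj, ← NNReal.coe_inj, NNReal.coe_mul, coe_nndist, coe_nndist,
    NNReal.dist_eq, NNReal.dist_eq, NNReal.coe_mul, NNReal.coe_mul, ← mul_sub, abs_mul,
    NNReal.abs_eq]

/-- Max-linear combinations with repeated members can be written without repetitions. -/
lemma exists_sup_reindex {ι κ : Type*} (J : Finset ι) (w : ι → ℝ≥0) (σ : ι → κ) :
    ∃ (J' : Finset κ) (w' : κ → ℝ≥0), ∀ u : κ → ℝ≥0,
      (J.sup fun i => w i * u (σ i)) = J'.sup fun s => w' s * u s := by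
  classical
  refine ⟨J.image σ, fun s => (J.filter fun i => σ i = s).sup w, fun u => ?_⟩
  rw [Finset.sup_image]
  refine le_antisymm (Finset.sup_mono_fun fun i hi => ?_) (Finset.sup_le fun i _ => ?_)
  · have h1 : w i ≤ (J.filter fun j => σ j = σ i).sup w :=
      Finset.le_sup (Finset.mem_filter.2 ⟨hi, rfl⟩)
    exact mul_le_mul_left h1 (u (σ i))
  · simp only [Function.comp_apply]
    rw [NNReal.finset_sup_mul]
    refine Finset.sup_le fun j hj => ?_
    obtain ⟨hj, hji⟩ := Finset.mem_filter.1 hj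
    rw [← hji]
    exact Finset.le_sup (f := fun i => w i * u (σ i)) hj

section Extension

variable {T Ω : Type*} [MeasurableSpace Ω] {P : Measure Ω} [IsProbabilityMeasure P]
  {U : T → Ω → ℝ≥0} {V : Finset T → (T → ℝ≥0) → ℝ≥0} {T₀ : Set T}

/-- Spectral functions of a separable max-stable family, on the compact space `[0, 1] ^ T₀`. The
distance of two of them in `L¹` is determined by the scales of max-linear combinations, so that
limits of the process give rise to limits of spectral functions. -/
theorem exists_spectralFunctions (hT₀ : T₀.Countable)
    (hV : ∀ J w, HasFrechetLaw P (fun ω => J.sup fun t => w t * U t ω) (V J w))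
    (hsep : ∀ t, ∃ τ : ℕ → T₀, ∀ᵐ ω ∂P, Tendsto (fun n => U (τ n) ω) atTop (𝓝 (U t ω))) :
    ∃ (c : T₀ → ℝ≥0) (Q : Measure (T₀ → Icc (0 : ℝ≥0) 1)) (g : T → (T₀ → Icc (0 : ℝ≥0) 1) → ℝ≥0),
      IsFiniteMeasure Q ∧ (∀ i, 0 < c i) ∧ (∀ t, Measurable (g t)) ∧
      (∀ (i : T₀) k, g i k = (k i : ℝ≥0) / c i) ∧
      (∀ J w, ∫⁻ k, ((J.sup fun t => w t * g t k : ℝ≥0) : ℝ≥0∞) ∂Q = V J w) ∧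
      Tendsto (fun J : Finset T₀ => ∫⁻ k, ((J.sup fun i => (k i : ℝ≥0) : ℝ≥0) : ℝ≥0∞) ∂Q) atTop
        (𝓝 (Q univ)) := by
  classical
  have hfst : Tendsto (Prod.fst : ℕ × ℕ → ℕ) atTop atTop := by
    rw [← prod_atTop_atTop_eq]; exact tendsto_fst
  have hsnd : Tendsto (Prod.snd : ℕ × ℕ → ℕ) atTop atTop := by
    rw [← prod_atTop_atTop_eq]; exact tendsto_snd
  have := hT₀.to_subtype
  obtain ⟨V₀, hV₀⟩ : ∃ V₀ : Finset T₀ → (T₀ → ℝ≥0) → ℝ≥0, ∀ J w,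
      HasFrechetLaw P (fun ω => J.sup fun i => w i * U i ω) (V₀ J w) := by
    refine ⟨fun J w => V (J.map (Function.Embedding.subtype _))
      (fun t => if h : t ∈ T₀ then w ⟨t, h⟩ else 0), fun J w => ?_⟩
    have h1 := hV (J.map (Function.Embedding.subtype _))
      (fun t => if h : t ∈ T₀ then w ⟨t, h⟩ else 0)
    simpa [Finset.sup_map, Function.comp_def] using h1
  obtain ⟨c, Q, hfin, hc, hQ, hlim⟩ := exists_spectralMeasure hV₀
  obtain ⟨g₀, hg₀⟩ : ∃ g₀ : T₀ → (T₀ → Icc (0 : ℝ≥0) 1) → ℝ≥0,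
      ∀ i k, g₀ i k = (k i : ℝ≥0) / c i := ⟨_, fun _ _ => rfl⟩
  have hg₀m (i : T₀) : Measurable (g₀ i) := by
    have : g₀ i = fun k => (k i : ℝ≥0) / c i := funext (hg₀ i)
    rw [this]
    fun_prop
  simp_rw [← hg₀] at hQ
  have hone (i : T₀) : HasFrechetLaw P (U i) (V₀ {i} 1) := by simpa using hV₀ {i} 1
  have hQone (i : T₀) : ∫⁻ k, (g₀ i k : ℝ≥0∞) ∂Q = V₀ {i} 1 := by simpa using hQ {i} 1
  have hmax (i j : T₀) : HasFrechetLaw P (fun ω => max (U i ω) (U j ω)) (V₀ {i, j} 1) := by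
    simpa [Finset.sup_insert] using hV₀ {i, j} 1
  have hQmax (i j : T₀) : ∫⁻ k, ((max (g₀ i k) (g₀ j k) : ℝ≥0) : ℝ≥0∞) ∂Q = V₀ {i, j} 1 := by
    simpa [Finset.sup_insert] using hQ {i, j} 1
  have hedist (i j : T₀) : ∫⁻ k, edist (g₀ i k) (g₀ j k) ∂Q =
      2 * (V₀ {i, j} 1 : ℝ≥0∞) - (V₀ {i} 1 + V₀ {j} 1) := by
    refine ENNReal.eq_sub_of_add_eq (by simp) ?_
    rw [← hQone i, ← hQone j, ← hQmax i j,
      ← lintegral_add_left (hg₀m i).coe_nnreal_ennreal, ← lintegral_add_left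
      ((hg₀m i).edist (hg₀m j)), ← lintegral_const_mul' _ _ ENNReal.ofNat_ne_top]
    exact lintegral_congr fun k => edist_add_add_eq _ _
  have hex (t : T) : ∃ (τ : ℕ → T₀) (G : (T₀ → Icc (0 : ℝ≥0) 1) → ℝ≥0),
      (∀ᵐ ω ∂P, Tendsto (fun n => U (τ n) ω) atTop (𝓝 (U t ω))) ∧ Measurable G ∧
      Tendsto (fun n => ∫⁻ k, edist (g₀ (τ n) k) (G k) ∂Q) atTop (𝓝 0) ∧
      ∀ h : t ∈ T₀, G = g₀ ⟨t, h⟩ := by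
    by_cases ht : t ∈ T₀
    · refine ⟨fun _ => ⟨t, ht⟩, g₀ ⟨t, ht⟩, Eventually.of_forall fun ω => tendsto_const_nhds,
        hg₀m _, ?_, fun _ => rfl⟩
      simp
    · obtain ⟨τ, hτ⟩ := hsep t
      have hUt : HasFrechetLaw P (U t) (V {t} 1) := by simpa using hV {t} 1
      have h1 : Tendsto (fun n => V₀ {τ n} 1) atTop (𝓝 (V {t} 1)) :=
        HasFrechetLaw.tendsto_scale (fun n => hone (τ n)) hUt hτ
      have h2 : Tendsto (fun n : ℕ × ℕ => V₀ {τ n.1, τ n.2} 1) atTop (𝓝 (V {t} 1)) := by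
        refine HasFrechetLaw.tendsto_scale (fun n => hmax (τ n.1) (τ n.2)) hUt ?_
        filter_upwards [hτ] with ω hω
        have := (hω.comp hfst).max (hω.comp hsnd)
        rwa [max_self] at this
      have h3 : Tendsto (fun n : ℕ × ℕ => ∫⁻ k, edist (g₀ (τ n.1) k) (g₀ (τ n.2) k) ∂Q) atTop
          (𝓝 0) := by
        simp_rw [hedist]
        have h4 := (ENNReal.tendsto_coe.2 h1).comp hfst
        have h5 := (ENNReal.tendsto_coe.2 h1).comp hsnd
        have h6 := ENNReal.Tendsto.sub (ENNReal.Tendsto.const_mul (a := 2)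
          (ENNReal.tendsto_coe.2 h2)
          (.inr ENNReal.ofNat_ne_top)) (h4.add h5) (.inr (by simp))
        rwa [two_mul, tsub_self] at h6
      obtain ⟨G, hGm, hG⟩ := exists_lintegral_edist_limit (fun n => hg₀m (τ n))
        (fun n => by rw [hQone]; exact ENNReal.coe_lt_top) h3
      exact ⟨τ, G, hτ, hGm, hG, fun h => absurd h ht⟩
  choose τ g hτ hgm hglim hgT₀ using hex
  refine ⟨c, Q, g, hfin, hc, hgm, fun i k => ?_, fun J w => ?_, ?_⟩
  · rw [hgT₀ i i.2, ← hg₀]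
  · have hscale (n : ℕ) : ∃ v : ℝ≥0,
        HasFrechetLaw P (fun ω => J.sup fun t => w t * U (τ t n) ω) v ∧
        ∫⁻ k, ((J.sup fun t => w t * g₀ (τ t n) k : ℝ≥0) : ℝ≥0∞) ∂Q = v := by
      obtain ⟨J', w', h⟩ := exists_sup_reindex J w fun t => τ t n
      refine ⟨V₀ J' w', ?_, ?_⟩
      · have h1 (ω : Ω) := h fun s => U s ω
        simp_rw [h1]
        exact hV₀ J' w'
      · have h1 (k) := h fun s => g₀ s k
        simp_rw [h1]
        exact hQ J' w'
    choose vn hvn hvnQ using hscale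
    have hvlim : Tendsto (fun n => (vn n : ℝ≥0∞)) atTop (𝓝 (V J w)) := by
      refine ENNReal.tendsto_coe.2 (HasFrechetLaw.tendsto_scale hvn (hV J w) ?_)
      have h1 : ∀ᵐ ω ∂P, ∀ t ∈ J, Tendsto (fun n => U (τ t n) ω) atTop (𝓝 (U t ω)) :=
        (ae_ball_iff J.countable_toSet).2 fun t _ => hτ t
      filter_upwards [h1] with ω hω
      exact Tendsto.finset_sup_nhds_apply fun t ht => (hω t ht).const_mul (w t)
    have herr : Tendsto (fun n => ∑ t ∈ J, (w t : ℝ≥0∞) *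
        ∫⁻ k, edist (g₀ (τ t n) k) (g t k) ∂Q) atTop (𝓝 0) := by
      have h1 := tendsto_finsetSum J fun t _ =>
        ENNReal.Tendsto.const_mul (a := (w t : ℝ≥0∞)) (hglim t) (.inr ENNReal.coe_ne_top)
      simpa only [mul_zero, Finset.sum_const_zero] using h1
    have hdist (n : ℕ) : ∫⁻ k, edist (J.sup fun t => w t * g₀ (τ t n) k)
        (J.sup fun t => w t * g t k) ∂Q ≤
        ∑ t ∈ J, (w t : ℝ≥0∞) * ∫⁻ k, edist (g₀ (τ t n) k) (g t k) ∂Q := by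
      have h1 (t : T) : Measurable fun k => edist (g₀ (τ t n) k) (g t k) :=
        (hg₀m _).edist (hgm t)
      calc _ ≤ ∫⁻ k, ∑ t ∈ J, (w t : ℝ≥0∞) * edist (g₀ (τ t n) k) (g t k) ∂Q := by
            refine lintegral_mono fun k => (edist_finset_sup_le J _ _).trans_eq ?_
            simp_rw [edist_mul_left_nnreal]
        _ = _ := by
            rw [lintegral_finsetSum _ fun t _ => (h1 t).const_mul _]
            simp_rw [lintegral_const_mul _ (h1 _)]
    have hm₁ (n : ℕ) : Measurable fun k => J.sup fun t => w t * g₀ (τ t n) k :=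
      measurable_finset_sup J fun t _ => (hg₀m _).const_mul _
    have hm₂ : Measurable fun k => J.sup fun t => w t * g t k :=
      measurable_finset_sup J fun t _ => (hgm t).const_mul _
    refine le_antisymm ?_ ?_
    · refine ge_of_tendsto' (by simpa only [add_zero] using hvlim.add herr) fun n => ?_
      rw [← hvnQ n]
      refine le_trans ?_ (add_le_add_right (hdist n) _)
      rw [← lintegral_add_left (hm₁ n).coe_nnreal_ennreal]
      exact lintegral_mono fun k => edist_comm (J.sup fun t => w t * g t k) _ ▸ le_add_edist _ _
    · refine le_of_tendsto_of_tendsto' hvlim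
        (by simpa only [add_zero] using (tendsto_const_nhds (x :=
          ∫⁻ k, ((J.sup fun t => w t * g t k : ℝ≥0) : ℝ≥0∞) ∂Q)).add herr) fun n => ?_
      rw [← hvnQ n]
      refine le_trans ?_ (add_le_add_right (hdist n) _)
      rw [← lintegral_add_left hm₂.coe_nnreal_ennreal]
      exact lintegral_mono fun k => le_add_edist _ _
  · refine hlim.congr fun J => ?_
    rw [← hQ J c]
    refine lintegral_congr fun k => ?_
    congr 1
    refine Finset.sup_congr rfl fun i _ => ?_
    rw [hg₀, mul_div_cancel₀ _ (hc i).ne']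

end Extension

/-! ### Standardization of finite measure spaces -/

/-- A right inverse of the distribution function of a nonatomic probability measure on the line
is injective and transports Lebesgue measure on `(0, 1)` to the given measure. -/
lemma exists_quantile (ν : Measure ℝ) [IsProbabilityMeasure ν] [NullSingletonClass ν] :
    ∃ q : ℝ → ℝ, Measurable q ∧ InjOn q (Ioo 0 1) ∧
      (volume.restrict (Ioo (0 : ℝ) 1)).map q = ν := by
  have hcont : Continuous (cdf ν) := by
    refine continuous_iff_continuousAt.2 fun x => ?_
    rw [(monotone_cdf ν).continuousAt_iff_leftLim_eq_rightLim, StieltjesFunction.rightLim_eq]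
    have h1 := (cdf ν).measure_singleton x
    rw [measure_cdf, measure_singleton] at h1
    have h2 := (monotone_cdf ν).leftLim_le (le_refl x)
    have h3 := ENNReal.ofReal_eq_zero.1 h1.symm
    linarith
  have hex (u : ℝ) : ∃ x, u ∈ Ioo (0 : ℝ) 1 → cdf ν x = u := by
    by_cases hu : u ∈ Ioo (0 : ℝ) 1
    · obtain ⟨x, hx⟩ := mem_range_of_exists_le_of_exists_ge hcont
        (((tendsto_cdf_atBot ν).eventually (gt_mem_nhds hu.1)).exists.imp fun _ h => h.le)
        (((tendsto_cdf_atTop ν).eventually (lt_mem_nhds hu.2)).exists.imp fun _ h => h.le)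
      exact ⟨x, fun _ => hx⟩
    · exact ⟨0, fun h => absurd h hu⟩
  choose q₀ hq₀ using hex
  set q : ℝ → ℝ := (Ioo (0 : ℝ) 1).indicator q₀ with hq
  have hqF (u : ℝ) (hu : u ∈ Ioo (0 : ℝ) 1) : cdf ν (q u) = u := by
    rw [hq, indicator_of_mem hu]; exact hq₀ u hu
  -- on `(0, 1)` the set `{q ≤ x}` lies between `{u | u < F x}` and `{u | u ≤ F x}`
  have hlt (x u : ℝ) (hu : u ∈ Ioo (0 : ℝ) 1) (h : u < cdf ν x) : q u ≤ x := by
    by_contra! h1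
    have := monotone_cdf ν h1.le
    rw [hqF u hu] at this
    linarith
  have hle (x u : ℝ) (hu : u ∈ Ioo (0 : ℝ) 1) (h : q u ≤ x) : u ≤ cdf ν x := by
    have := monotone_cdf ν h
    rwa [hqF u hu] at this
  have hsub (x : ℝ) : Ioo 0 1 ∩ q ⁻¹' Iic x =
      (Ioo 0 1 ∩ Iio (cdf ν x)) ∪ ({cdf ν x} ∩ (Ioo 0 1 ∩ q ⁻¹' Iic x)) := by
    ext u
    simp only [mem_inter_iff, mem_preimage, mem_Iic, mem_Iio, mem_union, mem_singleton_iff]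
    constructor
    · rintro ⟨hu, hux⟩
      rcases (hle x u hu hux).lt_or_eq with h | h
      · exact .inl ⟨hu, h⟩
      · exact .inr ⟨h, hu, hux⟩
    · rintro (⟨hu, h⟩ | ⟨_, h⟩)
      · exact ⟨hu, hlt x u hu h⟩
      · exact h
  have hmeas (x : ℝ) : MeasurableSet (Ioo 0 1 ∩ q ⁻¹' Iic x) := by
    rw [hsub]
    exact (measurableSet_Ioo.inter measurableSet_Iio).union
      (Set.Finite.measurableSet ((finite_singleton _).subset inter_subset_left))
  have hqm : Measurable q := by
    refine measurable_of_Iic fun x => ?_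
    rw [← inter_union_compl (q ⁻¹' Iic x) (Ioo 0 1), inter_comm]
    refine (hmeas x).union ?_
    have : q ⁻¹' Iic x ∩ (Ioo 0 1)ᶜ = {_u | 0 ≤ x} ∩ (Ioo 0 1)ᶜ := by
      ext u
      simp only [mem_inter_iff, mem_preimage, mem_Iic, mem_ofPred_eq]
      refine and_congr_left fun hu => ?_
      rw [hq, indicator_of_notMem hu]
    rw [this]
    exact (MeasurableSet.const _).inter measurableSet_Ioo.compl
  refine ⟨q, hqm, fun u hu u' hu' h => ?_, Measure.ext_of_Iic _ _ fun x => ?_⟩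
  · rw [← hqF u hu, ← hqF u' hu', h]
  · rw [Measure.map_apply hqm measurableSet_Iic,
      Measure.restrict_apply (hqm measurableSet_Iic), inter_comm, hsub]
    have h0 : volume ({cdf ν x} ∩ (Ioo 0 1 ∩ q ⁻¹' Iic x)) = 0 :=
      measure_mono_null inter_subset_left (by simp)
    rw [le_antisymm ((measure_union_le _ _).trans_eq (by rw [h0, add_zero]))
      (measure_mono subset_union_left)]
    have h1 : Ioo (0 : ℝ) 1 ∩ Iio (cdf ν x) = Ioo 0 (cdf ν x) := by
      ext u
      have := cdf_le_one ν x
      simp only [mem_inter_iff, mem_Ioo, mem_Iio]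
      constructor
      · rintro ⟨⟨h1, h2⟩, h3⟩; exact ⟨h1, h3⟩
      · rintro ⟨h1, h2⟩; exact ⟨⟨h1, by linarith⟩, h2⟩
    rw [h1, Real.volume_Ioo, sub_zero, ofReal_cdf]

/-- A nonatomic probability measure on a standard Borel space is the image of Lebesgue measure on
`(0, 1)` under a map that is injective up to a null set. -/
lemma exists_map_eq_of_noAtoms {K : Type*} [MeasurableSpace K] [StandardBorelSpace K] [Nonempty K]
    (Q : Measure K) [IsProbabilityMeasure Q] [NullSingletonClass Q] :
    ∃ (Ψ : ℝ → K) (R : Set ℝ), Measurable Ψ ∧ MeasurableSet R ∧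
      volume (Ioo (0 : ℝ) 1 \ R) = 0 ∧ InjOn Ψ (Ioo 0 1 ∩ R) ∧
      (volume.restrict (Ioo (0 : ℝ) 1)).map Ψ = Q := by
  have he := measurableEmbedding_embeddingReal K
  have hν : IsProbabilityMeasure (Q.map (embeddingReal K)) :=
    Measure.isProbabilityMeasure_map he.measurable.aemeasurable
  have hνa : NullSingletonClass (Q.map (embeddingReal K)) := by
    refine ⟨fun x => ?_⟩
    rw [he.map_apply]
    exact Set.Subsingleton.measure_zero (subsingleton_singleton.preimage he.injective) _
  obtain ⟨q, hqm, hqi, hq⟩ := exists_quantile (Q.map (embeddingReal K))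
  obtain ⟨inv, hinvm, hinv⟩ := he.exists_measurable_extend measurable_id fun _ => inferInstance
  refine ⟨inv ∘ q, q ⁻¹' range (embeddingReal K), hinvm.comp hqm,
    hqm he.measurableSet_range, ?_, ?_, ?_⟩
  · have h1 : (Q.map (embeddingReal K)) (range (embeddingReal K))ᶜ = 0 := by
      rw [he.map_apply]; simp
    rw [← hq, Measure.map_apply hqm he.measurableSet_range.compl,
      Measure.restrict_apply (hqm he.measurableSet_range.compl)] at h1
    rwa [sdiff_eq, inter_comm]
  · rintro u ⟨hu, k, hk⟩ u' ⟨hu', k', hk'⟩ h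
    have h1 (k : K) : inv (embeddingReal K k) = k := congrFun hinv k
    simp only [Function.comp_apply, ← hk, ← hk', h1] at h
    exact hqi hu hu' (by rw [← hk, ← hk', h])
  · rw [← Measure.map_map hinvm hqm, hq, Measure.map_map hinvm he.measurable, hinv, Measure.map_id]

/-- Every countable set is enumerated without repetition by the integers `1 ≤ k ≤ N`. -/
lemma exists_bijOn_of_countable {K : Type*} [Nonempty K] {A : Set K} (hA : A.Countable) :
    ∃ (N : ℕ∞) (a : ℕ → K), BijOn a {k : ℕ | 1 ≤ k ∧ (k : ℕ∞) ≤ N} A := by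
  rcases A.finite_or_infinite with hf | hi
  · have := hf.to_subtype
    have e := Finite.equivFin A
    refine ⟨(Nat.card A : ℕ), fun k => if h : k - 1 < Nat.card A then e.symm ⟨k - 1, h⟩ else
      Classical.arbitrary K, fun k hk => ?_, fun k hk l hl hkl => ?_, fun x hx => ?_⟩
    · have h1 : k - 1 < Nat.card A := by
        have := Nat.cast_le.1 hk.2
        have := hk.1
        omega
      simp only [h1, dif_pos]
      exact (e.symm ⟨k - 1, h1⟩).2
    · have hk2 := Nat.cast_le.1 hk.2
      have hl2 := Nat.cast_le.1 hl.2
      have hk1 := hk.1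
      have hl1 := hl.1
      have h1 : k - 1 < Nat.card A := by omega
      have h2 : l - 1 < Nat.card A := by omega
      simp only [h1, h2, dif_pos] at hkl
      have h3 := Fin.mk.inj (e.symm.injective (Subtype.ext hkl))
      omega
    · refine ⟨e ⟨x, hx⟩ + 1, ⟨by omega, ?_⟩, ?_⟩
      · exact Nat.cast_le.2 (e ⟨x, hx⟩).2
      · have h1 : (e ⟨x, hx⟩ : ℕ) + 1 - 1 < Nat.card A := (e ⟨x, hx⟩).2
        have h2 : (⟨(e ⟨x, hx⟩ : ℕ) + 1 - 1, h1⟩ : Fin (Nat.card A)) = e ⟨x, hx⟩ := rfl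
        simp only [h1, dif_pos, h2, Equiv.symm_apply_apply]
  · have := hi.to_subtype
    have := hA.to_subtype
    obtain ⟨_⟩ := nonempty_denumerable A
    have e := Denumerable.eqv A
    refine ⟨⊤, fun k => e.symm (k - 1), fun k hk => (e.symm (k - 1)).2,
      fun k hk l hl hkl => ?_, fun x hx => ?_⟩
    · have h3 := e.symm.injective (Subtype.ext hkl)
      have hk1 := hk.1
      have hl1 := hl.1
      omega
    · exact ⟨e ⟨x, hx⟩ + 1, ⟨by omega, le_top⟩, by simp⟩

section StdSupport

variable {I : Fin 2} {N : ℕ∞}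

lemma measurableSet_stdSupport (I : Fin 2) (N : ℕ∞) : MeasurableSet (stdSupport I N) := by
  refine MeasurableSet.union ((MeasurableSet.const _).inter measurableSet_Ioo) ?_
  refine Set.Countable.measurableSet ((countable_range ((↑) : ℕ → ℝ)).mono ?_)
  rintro _ ⟨k, _, _, rfl⟩
  exact ⟨k, rfl⟩

instance : SigmaFinite (stdMeasure I N) := by
  have he := MeasurableEmbedding.subtype_coe (measurableSet_stdSupport I N)
  refine Measure.sigmaFinite_of_countable
    (S := insert (Subtype.val ⁻¹' Iio 1) (range fun k : ℕ => Subtype.val ⁻¹' {(k : ℝ)}))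
    ((countable_range _).insert _) ?_ ?_
  · rintro B (rfl | ⟨k, rfl⟩)
    · rw [stdMeasure, he.comap_apply, Measure.add_apply, ENNReal.add_lt_top]
      refine ⟨measure_lt_top _ _, ?_⟩
      have h1 : Subtype.val '' (Subtype.val ⁻¹' Iio 1 : Set (stdSupport I N)) ∩
          range ((↑) : ℕ → ℝ) = ∅ := by
        rw [eq_empty_iff_forall_notMem]
        rintro _ ⟨⟨s, hs, rfl⟩, j, hj⟩
        rcases s.2 with h | ⟨k, hk, _, hsk⟩
        · have h2 := h.2.1
          have h3 := h.2.2
          rw [← hj] at h2 h3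
          have h4 := Nat.cast_pos.1 h2
          have h5 : j < 1 := by exact_mod_cast h3
          omega
        · have h2 : (s : ℝ) < 1 := hs
          rw [hsk] at h2
          have h3 : k < 1 := by exact_mod_cast h2
          omega
      rw [Measure.restrict_apply' (Set.countable_range _).measurableSet, h1, measure_empty]
      exact ENNReal.zero_lt_top
    · rw [stdMeasure, he.comap_apply]
      refine (measure_mono (image_preimage_subset _ _)).trans_lt ?_
      rw [Measure.add_apply, ENNReal.add_lt_top]
      refine ⟨measure_lt_top _ _, (Measure.restrict_apply_le _ _).trans_lt ?_⟩
      rw [Measure.count_singleton]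
      exact ENNReal.one_lt_top
  · refine eq_univ_of_forall fun s => ?_
    rcases s.2 with h | ⟨k, _, _, hsk⟩
    · exact ⟨_, mem_insert _ _, h.2.2⟩
    · exact ⟨_, mem_insert_of_mem _ ⟨k, rfl⟩, hsk⟩

lemma lintegral_stdMeasure (I : Fin 2) (N : ℕ∞) (G : ℝ → ℝ≥0∞) :
    ∫⁻ s, G s ∂stdMeasure I N = (∫⁻ x in {x | I = 1 ∧ x ∈ Ioo (0 : ℝ) 1}, G x) +
      ∑' k : {k : ℕ | 1 ≤ k ∧ (k : ℕ∞) ≤ N}, G (k : ℕ) := by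
  rw [stdMeasure, lintegral_subtype_comap (measurableSet_stdSupport I N) G, Measure.restrict_add,
    lintegral_add_measure, Measure.restrict_restrict (measurableSet_stdSupport I N),
    Measure.restrict_restrict (measurableSet_stdSupport I N)]
  congr 1
  · congr 2
    ext x
    constructor
    · rintro ⟨h | ⟨k, hk, _, rfl⟩, h'⟩
      · exact h
      · have h1 := h'.2
        have h2 : (1 : ℝ) ≤ k := by exact_mod_cast hk
        linarith
    · rintro ⟨h, hx⟩
      exact ⟨.inl ⟨h, hx⟩, hx⟩
  · have h1 : stdSupport I N ∩ range ((↑) : ℕ → ℝ) =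
        ((↑) : ℕ → ℝ) '' {k : ℕ | 1 ≤ k ∧ (k : ℕ∞) ≤ N} := by
      ext x
      constructor
      · rintro ⟨⟨_, h0, h1⟩ | ⟨k, hk, hkN, rfl⟩, ⟨j, hj⟩⟩
        · rw [← hj] at h0 h1
          have h2 := Nat.cast_pos.1 h0
          have h3 : j < 1 := by exact_mod_cast h1
          omega
        · exact ⟨k, ⟨hk, hkN⟩, rfl⟩
      · rintro ⟨k, ⟨hk, hkN⟩, rfl⟩
        exact ⟨.inr ⟨k, hk, hkN, rfl⟩, k, rfl⟩
    rw [h1, lintegral_countable _ ((Set.to_countable _).image _)]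
    simp only [Measure.count_singleton, mul_one]
    exact tsum_image G (Nat.cast_injective.injOn)

/-- Every finite measure on a standard Borel space is the image of a weighted standard measure,
under a map that is injective up to a null set: its atoms are labelled by integers, and its
nonatomic part by the points of `(0, 1)`. -/
theorem exists_standardization {K : Type*} [MeasurableSpace K] [StandardBorelSpace K] [Nonempty K]
    (Q : Measure K) [IsFiniteMeasure Q] :
    ∃ (I : Fin 2) (N : ℕ∞) (Φ : stdSupport I N → K) (h : stdSupport I N → ℝ≥0)
      (R : Set (stdSupport I N)), Measurable Φ ∧ Measurable h ∧ (∀ s, 0 < h s) ∧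
      MeasurableSet R ∧ stdMeasure I N Rᶜ = 0 ∧ InjOn Φ R ∧
      ∀ F : K → ℝ≥0∞, Measurable F → ∫⁻ s, h s * F (Φ s) ∂stdMeasure I N = ∫⁻ k, F k ∂Q := by
  set A : Set K := {k | 0 < Q {k}} with hA
  have hAc : A.Countable := Measure.countable_meas_pos_of_disjoint_iUnion
    (fun k => measurableSet_singleton k) fun k l hkl => disjoint_singleton.2 hkl
  have hAm : MeasurableSet A := hAc.measurableSet
  obtain ⟨N, a, ha⟩ := exists_bijOn_of_countable hAc
  obtain ⟨m, hm⟩ : ∃ m : ℝ≥0, (m : ℝ≥0∞) = Q Aᶜ := ⟨_, ENNReal.coe_toNNReal (measure_ne_top _ _)⟩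
  -- the nonatomic part
  obtain ⟨I, Ψ, R₀, hΨ, hR₀, hnull, hinj, hI, hmap⟩ : ∃ (I : Fin 2) (Ψ : ℝ → K) (R₀ : Set ℝ),
      Measurable Ψ ∧ MeasurableSet R₀ ∧ volume ({x | I = 1 ∧ x ∈ Ioo (0 : ℝ) 1} \ R₀) = 0 ∧
      InjOn Ψ ({x | I = 1 ∧ x ∈ Ioo (0 : ℝ) 1} ∩ R₀) ∧ (I = 1 → m ≠ 0) ∧
      m • (volume.restrict {x | I = 1 ∧ x ∈ Ioo (0 : ℝ) 1}).map Ψ = Q.restrict Aᶜ := by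
    rcases eq_or_ne m 0 with h0 | h0
    · refine ⟨0, fun _ => Classical.arbitrary K, univ, measurable_const, MeasurableSet.univ,
        by simp, by simp, by simp, ?_⟩
      rw [h0, ENNReal.coe_zero] at hm
      rw [h0, zero_smul, Measure.restrict_eq_zero.2 hm.symm]
    · have hprob : IsProbabilityMeasure (m⁻¹ • Q.restrict Aᶜ) := by
        refine ⟨?_⟩
        rw [Measure.smul_apply, Measure.restrict_apply_univ, ← hm, ENNReal.smul_def, smul_eq_mul,
          ← ENNReal.coe_mul, inv_mul_cancel₀ h0, ENNReal.coe_one]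
      have hna : NullSingletonClass (m⁻¹ • Q.restrict Aᶜ) := by
        refine ⟨fun k => ?_⟩
        rw [Measure.smul_apply, Measure.restrict_apply (measurableSet_singleton k)]
        by_cases hk : k ∈ A
        · rw [inter_comm, inter_singleton_eq_empty.2 (notMem_compl_iff.2 hk)]; simp
        · have h1 : Q {k} = 0 := by simpa [hA] using hk
          rw [measure_mono_null inter_subset_left h1]; simp
      obtain ⟨Ψ, R₀, hΨ, hR₀, hnull, hinj, hmap⟩ := exists_map_eq_of_noAtoms (m⁻¹ • Q.restrict Aᶜ)
      have h1 : {x : ℝ | (1 : Fin 2) = 1 ∧ x ∈ Ioo (0 : ℝ) 1} = Ioo 0 1 := by ext; simp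
      refine ⟨1, Ψ, R₀, hΨ, hR₀, by rwa [h1], by rwa [h1], fun _ => h0, ?_⟩
      rw [h1, hmap, smul_smul, mul_inv_cancel₀ h0, one_smul]
  -- points of `(0, 1)` and integers are told apart by the order
  have hcases (s : stdSupport I N) : ((s : ℝ) < 1 ∧ I = 1 ∧ (s : ℝ) ∈ Ioo (0 : ℝ) 1) ∨
      (¬ (s : ℝ) < 1 ∧ ∃ k : ℕ, (1 ≤ k ∧ (k : ℕ∞) ≤ N) ∧ (s : ℝ) = k) := by
    rcases s.2 with h | ⟨k, hk, hkN, hs⟩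
    · exact .inl ⟨h.2.2, h⟩
    · refine .inr ⟨?_, k, ⟨hk, hkN⟩, hs⟩
      rw [hs, not_lt]
      exact_mod_cast hk
  set Φ : ℝ → K := fun x => if x < 1 then Ψ x else a ⌊x⌋₊ with hΦ
  set h : ℝ → ℝ≥0 := fun x => if x < 1 then m else (Q {a ⌊x⌋₊}).toNNReal with hh
  have hΦm : Measurable Φ := Measurable.ite measurableSet_Iio hΨ
    ((measurable_of_countable a).comp Nat.measurable_floor)
  have hhm : Measurable h := Measurable.ite measurableSet_Iio measurable_const
    ((measurable_of_countable fun n : ℕ => (Q {a n}).toNNReal).comp Nat.measurable_floor)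
  set R : Set ℝ := {x | x < 1 → x ∈ R₀ ∩ Ψ ⁻¹' Aᶜ} with hR
  have hRm : MeasurableSet R := by
    have : R = (Iio 1)ᶜ ∪ (R₀ ∩ Ψ ⁻¹' Aᶜ) := by
      ext x; simp only [hR, mem_ofPred_eq, mem_union, mem_compl_iff, mem_Iio]; tauto
    rw [this]
    exact measurableSet_Iio.compl.union (hR₀.inter (hΨ hAm.compl))
  have hnot (k : ℕ) (hk : 1 ≤ k) : ¬ (k : ℝ) < 1 := not_lt.2 (by exact_mod_cast hk)
  refine ⟨I, N, fun s => Φ s, fun s => h s, Subtype.val ⁻¹' R, hΦm.comp measurable_subtype_coe,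
    hhm.comp measurable_subtype_coe, fun s => ?_, measurable_subtype_coe hRm, ?_, ?_, ?_⟩
  · rcases hcases s with ⟨h1, h2, -⟩ | ⟨h1, k, hk, hs⟩
    · simp only [hh, if_pos h1]
      exact pos_iff_ne_zero.2 (hI h2)
    · simp only [hh, if_neg (hnot k hk.1), hs, Nat.floor_natCast]
      exact ENNReal.toNNReal_pos (ha.mapsTo hk).ne' (measure_ne_top _ _)
  · have h1 : stdMeasure I N (Subtype.val ⁻¹' R)ᶜ =
        ∫⁻ s, Rᶜ.indicator (fun _ => (1 : ℝ≥0∞)) (s : ℝ) ∂stdMeasure I N := by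
      rw [← preimage_compl, ← lintegral_indicator_one (measurable_subtype_coe hRm.compl)]
      rfl
    rw [h1, lintegral_stdMeasure, add_eq_zero]
    constructor
    · rw [lintegral_indicator_const hRm.compl, one_mul, Measure.restrict_apply hRm.compl]
      have h2 : volume ({x | I = 1 ∧ x ∈ Ioo (0 : ℝ) 1} ∩ Ψ ⁻¹' A) = 0 := by
        by_cases hI1 : I = 1
        · have h3 := congrArg (fun μ : Measure K => μ A) hmap
          simp only [Measure.smul_apply, Measure.restrict_apply hAm, inter_compl_self,
            measure_empty,
            Measure.map_apply hΨ hAm, Measure.restrict_apply (hΨ hAm), ENNReal.smul_def,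
            smul_eq_mul, mul_eq_zero, ENNReal.coe_eq_zero, hI hI1, false_or] at h3
          rwa [inter_comm]
        · simp [hI1]
      refine measure_mono_null ?_ (measure_union_null hnull h2)
      rintro x ⟨hxR, hx⟩
      simp only [hR, mem_compl_iff, mem_ofPred_eq, not_forall] at hxR
      obtain ⟨_, h4⟩ := hxR
      by_cases h5 : x ∈ R₀
      · refine .inr ⟨hx, ?_⟩
        by_contra h6
        exact h4 ⟨h5, h6⟩
      · exact .inl ⟨hx, h5⟩
    · rw [ENNReal.tsum_eq_zero]
      intro k
      have : ((k : ℕ) : ℝ) ∉ Rᶜ := fun h2 => h2 fun h3 => absurd h3 (hnot k k.2.1)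
      rw [indicator_of_notMem this]
  · intro s hs s' hs' hss'
    simp only [mem_preimage, hR, mem_ofPred_eq] at hs hs'
    rcases hcases s with ⟨h1, h2⟩ | ⟨h1, k, hk, h2⟩ <;>
      rcases hcases s' with ⟨h1', h2'⟩ | ⟨h1', k', hk', h2'⟩
    · simp only [hΦ, if_pos h1, if_pos h1'] at hss'
      exact Subtype.ext (hinj ⟨h2, (hs h1).1⟩ ⟨h2', (hs' h1').1⟩ hss')
    · simp only [hΦ, if_pos h1, if_neg (hnot k' hk'.1), h2', Nat.floor_natCast] at hss'
      exact absurd (hss' ▸ ha.mapsTo hk') (hs h1).2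
    · simp only [hΦ, if_neg (hnot k hk.1), if_pos h1', h2, Nat.floor_natCast] at hss'
      exact absurd (hss' ▸ ha.mapsTo hk) (hs' h1').2
    · simp only [hΦ, if_neg (hnot k hk.1), if_neg (hnot k' hk'.1), h2, h2',
        Nat.floor_natCast] at hss'
      refine Subtype.ext ?_
      rw [h2, h2', ha.injOn hk hk' hss']
  · intro F hF
    have h1 := lintegral_stdMeasure I N fun x => h x * F (Φ x)
    refine h1.trans ?_
    rw [← lintegral_add_compl F hAm, add_comm]
    congr 1
    · rw [lintegral_countable _ hAc, ← (ha.equiv a).tsum_eq]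
      refine tsum_congr fun k => ?_
      have hk : (ha.equiv a k : K) = a k := rfl
      simp only [hh, hΦ, if_neg (hnot k k.2.1), Nat.floor_natCast, hk]
      rw [ENNReal.coe_toNNReal (measure_ne_top _ _), mul_comm]
    · rw [← hmap, lintegral_smul_measure, lintegral_map hF hΨ, ENNReal.smul_def, smul_eq_mul,
        ← lintegral_const_mul (f := fun x => F (Ψ x)) _ (hF.comp hΨ)]
      refine setLIntegral_congr_fun ((MeasurableSet.const _).inter measurableSet_Ioo) fun x hx => ?_
      simp only [hh, hΦ, if_pos hx.2.2]

end StdSupport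

/-! ### Equality in law from distribution functions -/

lemma measure_le_eq_zero_of_neg {Ω ι : Type*} [MeasurableSpace Ω] {P : Measure Ω} {X : ι → Ω → ℝ}
    (hX0 : ∀ i, ∀ᵐ ω ∂P, 0 ≤ X i ω) {x : ι → ℝ} {i : ι} (hi : x i < 0) :
    P {ω | ∀ i, X i ω ≤ x i} = 0 := by
  refine measure_mono_null (fun ω hω => ?_) (ae_iff.1 (hX0 i))
  exact not_le.2 ((hω i).trans_lt hi)

/-- Distribution functions are right continuous. -/
lemma tendsto_measure_le_add {Ω ι : Type*} [Countable ι] [MeasurableSpace Ω] {P : Measure Ω}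
    [IsProbabilityMeasure P] {X : ι → Ω → ℝ} (hX : ∀ i, AEMeasurable (X i) P) (x : ι → ℝ) :
    Tendsto (fun n : ℕ => P {ω | ∀ i, X i ω ≤ x i + 1 / ((n : ℝ) + 1)}) atTop
      (𝓝 (P {ω | ∀ i, X i ω ≤ x i})) := by
  have h1 : {ω | ∀ i, X i ω ≤ x i} = ⋂ n : ℕ, {ω | ∀ i, X i ω ≤ x i + 1 / ((n : ℝ) + 1)} := by
    ext ω
    simp only [mem_ofPred_eq, mem_iInter]
    refine ⟨fun h n i => (h i).trans (le_add_of_nonneg_right (by positivity)), fun h i => ?_⟩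
    have := (tendsto_one_div_add_atTop_nhds_zero_nat (𝕜 := ℝ)).const_add (x i)
    rw [add_zero] at this
    exact ge_of_tendsto' this fun n => h n i
  rw [h1]
  refine tendsto_measure_iInter_atTop (fun n => ?_) (fun n m hnm ω hω i => (hω i).trans ?_)
    ⟨0, measure_ne_top _ _⟩
  · rw [ofPred_forall]
    exact NullMeasurableSet.iInter fun i => nullMeasurableSet_le (hX i) aemeasurable_const
  · gcongr

/-- Nonnegative random vectors have the same law if their distribution functions agree at all
positive levels. -/
lemma identDistrib_of_measure_le {Ω Ω' ι : Type*} [Fintype ι] [MeasurableSpace Ω]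
    [MeasurableSpace Ω'] {P : Measure Ω} {Q : Measure Ω'} [IsProbabilityMeasure P]
    [IsProbabilityMeasure Q] {X : ι → Ω → ℝ} {Y : ι → Ω' → ℝ} (hX : ∀ i, AEMeasurable (X i) P)
    (hY : ∀ i, AEMeasurable (Y i) Q) (hX0 : ∀ i, ∀ᵐ ω ∂P, 0 ≤ X i ω) (hY0 : ∀ i, ∀ᵐ ω ∂Q, 0 ≤ Y i ω)
    (h : ∀ x : ι → ℝ, (∀ i, 0 < x i) → P {ω | ∀ i, X i ω ≤ x i} = Q {ω | ∀ i, Y i ω ≤ x i}) :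
    IdentDistrib (fun ω i => X i ω) (fun ω i => Y i ω) P Q := by
  have hXm : AEMeasurable (fun ω i => X i ω) P := aemeasurable_pi_iff.2 hX
  have hYm : AEMeasurable (fun ω i => Y i ω) Q := aemeasurable_pi_iff.2 hY
  refine ⟨hXm, hYm, ?_⟩
  have := Measure.isProbabilityMeasure_map hXm
  have := Measure.isProbabilityMeasure_map hYm
  have hgen : (MeasurableSpace.pi : MeasurableSpace (ι → ℝ)) =
      MeasurableSpace.generateFrom (Set.pi univ '' Set.pi univ fun _ : ι => range Iic) := by
    refine (generateFrom_eq_pi (fun _ => ?_) fun _ => ?_).symm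
    · rw [← borel_eq_generateFrom_Iic, BorelSpace.measurable_eq (α := ℝ)]
    · refine ⟨fun n : ℕ => Iic (n : ℝ), fun n => ⟨_, rfl⟩, ?_⟩
      exact eq_univ_of_forall fun x => mem_iUnion.2 (exists_nat_ge x)
  refine ext_of_generate_finite _ hgen (IsPiSystem.pi fun _ => ?_) ?_ (by simp)
  · rw [← image_univ]; exact isPiSystem_image_Iic _
  rintro _ ⟨B, hB, rfl⟩
  have hB' (i : ι) : ∃ x : ℝ, Iic x = B i := hB i (mem_univ i)
  choose x hx using hB'
  have hm : MeasurableSet (Set.pi univ B) := MeasurableSet.univ_pi fun i => hx i ▸ measurableSet_Iic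
  have hpre : Set.pi univ B = {y | ∀ i, y i ≤ x i} := by
    ext y
    simp [← hx]
  rw [Measure.map_apply_of_aemeasurable hXm hm, Measure.map_apply_of_aemeasurable hYm hm, hpre]
  change P {ω | ∀ i, X i ω ≤ x i} = Q {ω | ∀ i, Y i ω ≤ x i}
  by_cases hpos : ∃ i, x i < 0
  · obtain ⟨i, hi⟩ := hpos
    rw [measure_le_eq_zero_of_neg hX0 hi, measure_le_eq_zero_of_neg hY0 hi]
  · push Not at hpos
    refine tendsto_nhds_unique (tendsto_measure_le_add hX x) ?_
    have h1 (n : ℕ) := h (fun i => x i + 1 / ((n : ℝ) + 1)) fun i =>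
      add_pos_of_nonneg_of_pos (hpos i) (by positivity)
    simp_rw [h1]
    exact tendsto_measure_le_add hY x

/-! ### Spectral representations and minimality -/

section Final

variable {T Ω : Type*} {α : ℝ}

lemma mem_maxSpan {S ι : Type*} {F : Set (S → ℝ≥0)} {J : Finset ι} (hJ : J.Nonempty) {a : ι → ℝ≥0}
    (ha : ∀ i, 0 < a i) {g : ι → S → ℝ≥0} (hg : ∀ i, g i ∈ F) :
    (fun s => J.sup fun i => a i * g i s) ∈ maxSpan F := by
  have e := J.equivFin
  refine ⟨J.card, fun n => a (e.symm n), fun n => g (e.symm n), hJ.card_pos, fun n => ha _,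
    fun n => hg _, ?_⟩
  ext1 s
  refine le_antisymm (Finset.sup_le fun i hi => ?_) (Finset.sup_le fun n _ => ?_)
  · have h1 : e.symm (e ⟨i, hi⟩) = ⟨i, hi⟩ := e.symm_apply_apply _
    have h2 := Finset.le_sup (f := fun n => a (e.symm n) * g (e.symm n) s)
      (Finset.mem_univ (e ⟨i, hi⟩))
    rwa [h1] at h2
  · exact Finset.le_sup (f := fun i => a i * g i s) (e.symm n).2

lemma nnreal_sup_rpow {ι : Type*} (J : Finset ι) (u : ι → ℝ≥0) {p : ℝ} (hp : 0 < p) :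
    (J.sup u) ^ p = J.sup fun i => u i ^ p :=
  Finset.apply_sup_eq_sup_comp_of_linearOrder (fun x : ℝ≥0 => x ^ p)
    (NNReal.monotone_rpow_of_nonneg hp.le) (by simp [hp.ne'])

lemma measurable_ratio {S : Type*} {F : Set (S → ℝ≥0)} {f g : S → ℝ≥0} (hf : f ∈ F) (hg : g ∈ F) :
    Measurable[ratioSigmaField F] fun s => (f s : ℝ≥0∞) / (g s : ℝ≥0∞) :=
  (comap_measurable _).mono (le_iSup₂_of_le f hf (le_iSup₂_of_le g hg le_rfl)) le_rfl

/-- If `sup_i k i = 1`, then `k j` is recovered from the quotients `k j / k i`. -/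
lemma iInf_div_eq {ι : Type*} [Nonempty ι] {k : ι → ℝ≥0} (hk : ⨆ i, (k i : ℝ≥0∞) = 1) (j : ι) :
    ⨅ i, (k j : ℝ≥0∞) / k i = k j := by
  rcases eq_or_ne (k j) 0 with h | h
  · simp [h]
  · simp_rw [div_eq_mul_inv]
    rw [← ENNReal.mul_iInf_of_ne (ENNReal.coe_ne_zero.2 h) ENNReal.coe_ne_top, ← ENNReal.inv_iSup,
      hk, inv_one, mul_one]

/-- The point of `[0, 1] ^ ι` with coordinates the infima of weighted powers of quotients. -/
noncomputable def coordOfRatio {S ι : Type*} (α : ℝ) (c : ι → ℝ≥0) (r : ι → ι → S → ℝ≥0∞) (s : S)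
    (j : ι) : Icc (0 : ℝ≥0) 1 :=
  ⟨min (⨅ i, r j i s ^ α * ((c j : ℝ≥0∞) / c i)).toNNReal 1, zero_le, min_le_right _ _⟩

lemma measurable_coordOfRatio {S ι : Type*} [Countable ι] [MeasurableSpace S] {c : ι → ℝ≥0}
    {r : ι → ι → S → ℝ≥0∞} (hr : ∀ i j, Measurable (r i j)) : Measurable (coordOfRatio α c r) := by
  refine measurable_pi_lambda _ fun j => Measurable.subtype_mk ?_
  exact (Measurable.iInf fun i => ((hr j i).pow_const α).mul_const _).ennreal_toNNReal.min
    measurable_const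

lemma rpow_div_mul_div_eq (hα : 0 < α) {h a b c d : ℝ≥0} (hh : 0 < h) (hc : 0 < c) (hd : 0 < d) :
    ((((h * (a / c)) ^ (1 / α) : ℝ≥0) : ℝ≥0∞) / (((h * (b / d)) ^ (1 / α) : ℝ≥0) : ℝ≥0∞)) ^ α *
      ((c : ℝ≥0∞) / d) = (a : ℝ≥0∞) / b := by
  rw [ENNReal.div_rpow_of_nonneg _ _ hα.le, ← ENNReal.coe_rpow_of_nonneg _ hα.le,
    ← ENNReal.coe_rpow_of_nonneg _ hα.le, ← NNReal.rpow_mul, ← NNReal.rpow_mul,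
    one_div_mul_cancel hα.ne', NNReal.rpow_one, NNReal.rpow_one]
  rcases eq_or_ne b 0 with rfl | hb
  · rcases eq_or_ne a 0 with rfl | ha
    · simp
    · have h1 : ((h * (a / c) : ℝ≥0) : ℝ≥0∞) ≠ 0 := by
        simp [hh.ne', ha, hc.ne']
      have h2 : (c : ℝ≥0∞) / d ≠ 0 := by simp [hc.ne']
      rw [zero_div, mul_zero, ENNReal.coe_zero, ENNReal.div_zero h1,
        ENNReal.div_zero (ENNReal.coe_ne_zero.2 ha), ENNReal.top_mul h2]
  · have hb' : h * (b / d) ≠ 0 := by positivity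
    rw [← ENNReal.coe_div hb', ← ENNReal.coe_div hd.ne', ← ENNReal.coe_div hb, ← ENNReal.coe_mul]
    congr 1
    field_simp

/-- The spectral functions on `(S, μ)` given by functions on `(K, Q)`, a map `Φ : S → K` and a
density `h`. -/
noncomputable def transport {S K : Type*} (α : ℝ) (g : T → K → ℝ≥0) (Φ : S → K) (h : S → ℝ≥0)
    (t : T) (s : S) : ℝ≥0 :=
  (h s * g t (Φ s)) ^ (1 / α)

lemma coe_transport_rpow {S K : Type*} (hα : 0 < α) (g : T → K → ℝ≥0) (Φ : S → K) (h : S → ℝ≥0)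
    (t : T) (s : S) :
    (transport α g Φ h t s : ℝ≥0∞) ^ α = h s * g t (Φ s) := by
  rw [transport, ← ENNReal.coe_rpow_of_nonneg _ hα.le, ← NNReal.rpow_mul,
    one_div_mul_cancel hα.ne', NNReal.rpow_one, ENNReal.coe_mul]

variable {S K : Type*} [MeasurableSpace S] [MeasurableSpace K] {μ : Measure S} {Q : Measure K}
  {g : T → K → ℝ≥0} {Φ : S → K} {h : S → ℝ≥0}

lemma memLPlus_transport (hα : 0 < α) (hg : ∀ t, Measurable (g t)) (hΦ : Measurable Φ)
    (hh : Measurable h)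
    (hint : ∀ F : K → ℝ≥0∞, Measurable F → ∫⁻ s, h s * F (Φ s) ∂μ = ∫⁻ k, F k ∂Q) (t : T)
    (hfin : ∫⁻ k, g t k ∂Q < ∞) : MemLPlus α μ (transport α g Φ h t) := by
  refine ⟨(hh.mul ((hg t).comp hΦ)).pow_const _, ?_⟩
  simp_rw [coe_transport_rpow hα g Φ h]
  rwa [hint _ (hg t).coe_nnreal_ennreal]

/-- Functions with the right integrals of weighted maxima give a spectral representation. -/
theorem isSpectralRepresentation_transport {S : Type} [MeasurableSpace S] {μ : Measure S}
    [SFinite μ] {Φ : S → K} {h : S → ℝ≥0} [MeasurableSpace Ω] {P : Measure Ω}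
    [IsProbabilityMeasure P] {X : T → Ω → ℝ} (hα : 0 < α) (hX : IsFrechetProcess α X P)
    {V : Finset T → (T → ℝ≥0) → ℝ≥0}
    (hV : ∀ J w, HasFrechetLaw P (fun ω => J.sup fun t => w t * powProcess α X t ω) (V J w))
    (hg : ∀ t, Measurable (g t))
    (hgV : ∀ J w, ∫⁻ k, ((J.sup fun t => w t * g t k : ℝ≥0) : ℝ≥0∞) ∂Q = V J w)
    (hΦ : Measurable Φ) (hh : Measurable h)
    (hint : ∀ F : K → ℝ≥0∞, Measurable F → ∫⁻ s, h s * F (Φ s) ∂μ = ∫⁻ k, F k ∂Q) :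
    IsSpectralRepresentation α X P μ (transport α g Φ h) := by
  have hmem (t : T) : MemLPlus α μ (transport α g Φ h t) := by
    refine memLPlus_transport hα hg hΦ hh hint t ?_
    have := hgV {t} 1
    simp only [Finset.sup_singleton, Pi.one_apply, one_mul] at this
    rw [this]
    exact ENNReal.coe_lt_top
  have hm (t : T) : Measurable fun s => (transport α g Φ h t s : ℝ≥0∞) :=
    (hmem t).1.coe_nnreal_ennreal
  refine ⟨hmem, _, _, poissonLaw (intensity μ), inferInstance, supMeasure α,
    fun t ω => (supIntegral α (fun s => transport α g Φ h t s) ω).toReal,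
    isRandomSupMeasure_supMeasure hα μ, fun t => isExtremalIntegral_supIntegral hα μ (hmem t),
    fun J => ?_⟩
  classical
  refine identDistrib_of_measure_le (fun t => hX.aemeasurable t)
    (fun t => (measurable_supIntegral (hm t)).ennreal_toReal.aemeasurable) (fun t => hX.nonneg t)
    (fun t => Eventually.of_forall fun ω => ENNReal.toReal_nonneg) fun x hx => ?_
  obtain ⟨y, hy⟩ : ∃ y : T → ℝ≥0, ∀ t : J, y t = (x t).toNNReal :=
    ⟨fun t => if h : t ∈ J then (x ⟨t, h⟩).toNNReal else 0, fun t => by simp⟩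
  have hy0 (t : J) : 0 < y t := by rw [hy]; exact Real.toNNReal_pos.2 (hx t)
  have h1 : P {ω | ∀ t : J, X t ω ≤ x t} = expNeg (V J fun t => (y t ^ α)⁻¹) := by
    have h2 := (hV J fun t => (y t ^ α)⁻¹).cdf 1 one_pos
    rw [div_one] at h2
    rw [← h2]
    congr 1
    ext ω
    simp only [mem_ofPred_eq, Finset.sup_le_iff, powProcess]
    have h3 (t : J) : X t ω ≤ x t ↔ (y t ^ α)⁻¹ * (X t ω).toNNReal ^ α ≤ 1 := by
      rw [inv_mul_le_iff₀ (NNReal.rpow_pos (hy0 t)), mul_one, NNReal.rpow_le_rpow_iff hα, hy,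
        Real.toNNReal_le_toNNReal_iff (hx t).le]
    simp_rw [h3]
    exact ⟨fun h t ht => h ⟨t, ht⟩, fun h t => h t t.2⟩
  have h4 : poissonLaw (intensity μ) {ω | ∀ t : J,
      (supIntegral α (fun s => transport α g Φ h t s) ω).toReal ≤ x t} =
      poissonLaw (intensity μ) {ω | ∀ t ∈ J,
      supIntegral α (fun s => (transport α g Φ h t s : ℝ≥0∞)) ω ≤ (y t : ℝ≥0∞)} := by
    have h5 : ∀ᵐ ω ∂poissonLaw (intensity μ), ∀ t : J,
        supIntegral α (fun s => (transport α g Φ h t s : ℝ≥0∞)) ω < ∞ :=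
      ae_all_iff.2 fun t => supIntegral_lt_top hα μ (hmem t)
    refine measure_congr (h5.mono fun ω hω => ?_)
    apply propext
    have h6 (t : J) : (supIntegral α (fun s => (transport α g Φ h t s : ℝ≥0∞)) ω).toReal ≤ x t ↔
        supIntegral α (fun s => (transport α g Φ h t s : ℝ≥0∞)) ω ≤ (y t : ℝ≥0∞) := by
      rw [hy, ← ENNReal.le_ofReal_iff_toReal_le (hω t).ne (hx t).le]
      rfl
    change (∀ t : J, _) ↔ ∀ t ∈ J, _
    simp_rw [h6]
    exact ⟨fun h t ht => h ⟨t, ht⟩, fun h t => h t t.2⟩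
  rw [h1, h4, poissonLaw_supIntegral_le hα μ J _ (fun t _ => hm t), ← hgV]
  congr 1
  rw [← hint _ (measurable_finset_sup J fun t _ => (hg t).const_mul _).coe_nnreal_ennreal]
  refine lintegral_congr fun s => ?_
  rw [← ENNReal.coe_mul, NNReal.mul_finset_sup, ENNReal.coe_finset_sup]
  refine Finset.sup_congr rfl fun t ht => ?_
  have hyt : y t ^ α ≠ 0 := (NNReal.rpow_pos (hy0 ⟨t, ht⟩)).ne'
  rw [ENNReal.div_rpow_of_nonneg _ _ hα.le, coe_transport_rpow hα g Φ h,
    ← ENNReal.coe_rpow_of_nonneg _ hα.le, ← ENNReal.coe_mul, ← ENNReal.coe_div hyt]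
  congr 1
  rw [div_eq_mul_inv]
  ring

lemma iSup_coord_eq_one {ι : Type*} [Countable ι] {Q : Measure (ι → Icc (0 : ℝ≥0) 1)}
    [IsFiniteMeasure Q]
    (hlim : Tendsto (fun J : Finset ι => ∫⁻ k, ((J.sup fun i => (k i : ℝ≥0) : ℝ≥0) : ℝ≥0∞) ∂Q) atTop
      (𝓝 (Q univ))) : ∀ᵐ k ∂Q, ⨆ i, ((k i : ℝ≥0) : ℝ≥0∞) = 1 := by
  have hle (k : ι → Icc (0 : ℝ≥0) 1) : ⨆ i, ((k i : ℝ≥0) : ℝ≥0∞) ≤ 1 :=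
    iSup_le fun i => by exact_mod_cast (k i).2.2
  refine ae_eq_of_ae_le_of_lintegral_le (g := fun _ => 1) (Eventually.of_forall hle) ?_
    aemeasurable_const ?_
  · refine ((lintegral_mono hle).trans_lt ?_).ne
    rw [lintegral_one]
    exact measure_lt_top _ _
  · rw [lintegral_one]
    refine le_of_tendsto' hlim fun J => lintegral_mono fun k => ?_
    rw [ENNReal.coe_finset_sup]
    exact Finset.sup_le fun i _ => le_iSup (fun i => ((k i : ℝ≥0) : ℝ≥0∞)) i

/-- The spectral functions obtained from the coordinates of `[0, 1] ^ T₀` are minimal: the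
coordinates, whose supremum is `1`, are functions of their quotients. -/
theorem isMinimal_transport {T₀ : Set T} [Countable T₀] [Nonempty T₀] [StandardBorelSpace S]
    (hα : 0 < α) {Q : Measure (T₀ → Icc (0 : ℝ≥0) 1)} [IsFiniteMeasure Q] {c : T₀ → ℝ≥0}
    {g : T → (T₀ → Icc (0 : ℝ≥0) 1) → ℝ≥0} {Φ : S → T₀ → Icc (0 : ℝ≥0) 1} (hc : ∀ i, 0 < c i)
    (hgc : ∀ (i : T₀) k, g i k = (k i : ℝ≥0) / c i)
    (hlim : Tendsto (fun J : Finset T₀ => ∫⁻ k, ((J.sup fun i => (k i : ℝ≥0) : ℝ≥0) : ℝ≥0∞) ∂Q)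
      atTop (𝓝 (Q univ)))
    (hΦ : Measurable Φ) (hh : Measurable h) (hh0 : ∀ s, 0 < h s) {R : Set S} (hR : MeasurableSet R)
    (hRnull : μ Rᶜ = 0) (hinj : InjOn Φ R)
    (hint : ∀ F : (T₀ → Icc (0 : ℝ≥0) 1) → ℝ≥0∞, Measurable F →
      ∫⁻ s, h s * F (Φ s) ∂μ = ∫⁻ k, F k ∂Q) :
    IsMinimal α μ (transport α g Φ h) where
  support_eq := by
    have hf₀ (s : S) : (h s ^ (1 / α)) ^ α = h s := by
      rw [← NNReal.rpow_mul, one_div_mul_cancel hα.ne', NNReal.rpow_one]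
    have hsupp : Function.support (fun s => h s ^ (1 / α)) = univ :=
      eq_univ_of_forall fun s => (NNReal.rpow_pos (hh0 s)).ne'
    refine ⟨fun s => h s ^ (1 / α), ⟨⟨hh.pow_const _, ?_⟩, fun ε hε => ?_⟩, fun f _ => ?_, ?_⟩
    · have h1 := hint (fun _ => 1) measurable_const
      simp only [mul_one, lintegral_one] at h1
      simp_rw [← ENNReal.coe_rpow_of_nonneg _ hα.le, hf₀]
      rw [h1]
      exact measure_lt_top _ _
    · have hsub : Tendsto (fun J : Finset T₀ =>
          Q univ - ∫⁻ k, ((J.sup fun i => (k i : ℝ≥0) : ℝ≥0) : ℝ≥0∞) ∂Q) atTop (𝓝 0) := by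
        have := ENNReal.Tendsto.sub (tendsto_const_nhds (x := Q univ)) hlim
          (.inl (measure_ne_top _ _))
        rwa [tsub_self] at this
      obtain ⟨J, hJε, hJ⟩ := ((hsub.eventually (gt_mem_nhds hε)).and
        (eventually_ge_atTop {Classical.arbitrary T₀})).exists
      refine ⟨_, mem_maxSpan (J := J) ⟨_, hJ (Finset.mem_singleton_self _)⟩
        (a := fun i => c i ^ (1 / α)) (fun i => NNReal.rpow_pos (hc i))
        (g := fun i => transport α g Φ h i) (fun i => mem_range_self _), ?_⟩
      refine lt_of_le_of_lt (le_of_eq ?_) hJε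
      have hle (k : T₀ → Icc (0 : ℝ≥0) 1) : (J.sup fun i => (k i : ℝ≥0)) ≤ 1 :=
        Finset.sup_le fun i _ => (k i).2.2
      have hm : Measurable fun k : T₀ → Icc (0 : ℝ≥0) 1 => J.sup fun i => (k i : ℝ≥0) :=
        measurable_finset_sup J fun i _ => by fun_prop
      have hval (s : S) : (J.sup fun i => c i ^ (1 / α) * transport α g Φ h i s) ^ α =
          h s * J.sup fun i => (Φ s i : ℝ≥0) := by
        rw [nnreal_sup_rpow J _ hα, NNReal.mul_finset_sup]
        refine Finset.sup_congr rfl fun i _ => ?_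
        rw [transport, ← NNReal.mul_rpow, ← NNReal.rpow_mul, one_div_mul_cancel hα.ne',
          NNReal.rpow_one, hgc, mul_left_comm, mul_div_cancel₀ _ (hc i).ne']
      rw [← lintegral_one, ← lintegral_sub hm.coe_nnreal_ennreal]
      · have h1 := hint (fun k => 1 - ((J.sup fun i => (k i : ℝ≥0) : ℝ≥0) : ℝ≥0∞))
          (measurable_const.sub hm.coe_nnreal_ennreal)
        rw [← h1, distLPlus]
        refine lintegral_congr fun s => ?_
        rw [← NNReal.coe_rpow, ← NNReal.coe_rpow, hval, hf₀, abs_sub_comm, ← ENNReal.coe_one,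
          ← ENNReal.coe_sub, ← ENNReal.coe_mul, ← ENNReal.ofReal_coe_nnreal]
        congr 1
        rw [NNReal.coe_mul, NNReal.coe_mul, NNReal.coe_sub (hle _), NNReal.coe_one, mul_sub,
          mul_one,
          abs_of_nonneg]
        rw [sub_nonneg]
        exact mul_le_of_le_one_right (NNReal.coe_nonneg _) (hle (Φ s))
      · refine ((lintegral_mono fun k => ENNReal.coe_le_coe.2 (hle k)).trans_lt ?_).ne
        rw [ENNReal.coe_one, lintegral_one]
        exact measure_lt_top _ _
      · exact Eventually.of_forall fun k =>
          (ENNReal.coe_le_coe.2 (hle k)).trans_eq ENNReal.coe_one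
    · rw [hsupp]; simp
    · rw [hsupp]
      exact EventuallyEq.rfl
  ratio B hB := by
    set Θ : S → T₀ → Icc (0 : ℝ≥0) 1 := coordOfRatio α c fun i j s =>
      (transport α g Φ h i s : ℝ≥0∞) / transport α g Φ h j s with hΘ
    have hΘm : Measurable[ratioSigmaField (range (transport α g Φ h))] Θ :=
      @measurable_coordOfRatio _ _ _ _ (ratioSigmaField (range (transport α g Φ h))) _ _
        fun i j => measurable_ratio (mem_range_self _) (mem_range_self _)
    have hC : MeasurableSet (Φ '' (B ∩ R)) :=
      (hB.inter hR).image_of_measurable_injOn hΦ (hinj.mono inter_subset_right)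
    refine ⟨Θ ⁻¹' (Φ '' (B ∩ R)), hΘm hC, ?_⟩
    -- almost everywhere `Θ = Φ`
    have hsup : ∀ᵐ s ∂μ, ⨆ i, ((Φ s i : ℝ≥0) : ℝ≥0∞) = 1 := by
      set E : Set (T₀ → Icc (0 : ℝ≥0) 1) := {k | ⨆ i, ((k i : ℝ≥0) : ℝ≥0∞) ≠ 1} with hE
      have hEm : MeasurableSet E := by
        have h1 : Measurable fun k : T₀ → Icc (0 : ℝ≥0) 1 => ⨆ i, ((k i : ℝ≥0) : ℝ≥0∞) :=
          Measurable.iSup fun i => by fun_prop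
        exact (h1 (measurableSet_singleton 1)).compl
      have h1 := hint (E.indicator 1) (measurable_one.indicator hEm)
      rw [lintegral_indicator_one hEm, show Q E = 0 from ae_iff.1 (iSup_coord_eq_one hlim),
        lintegral_eq_zero_iff (f := fun s => (h s : ℝ≥0∞) * E.indicator 1 (Φ s))
          (hh.coe_nnreal_ennreal.mul ((measurable_one.indicator hEm).comp hΦ))] at h1
      filter_upwards [h1] with s hs
      by_contra h2
      have h3 : Φ s ∈ E := h2
      simp [h3, (hh0 s).ne'] at hs
    have hR' : ∀ᵐ s ∂μ, s ∈ R := hRnull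
    have hae : ∀ᵐ s ∂μ, s ∉ symmDiff (Θ ⁻¹' (Φ '' (B ∩ R))) B := by
      filter_upwards [hsup, hR'] with s hs hsR
      have hΘΦ : Θ s = Φ s := by
        ext1 j
        refine Subtype.ext ?_
        have h1 (i : T₀) : ((transport α g Φ h j s : ℝ≥0∞) / transport α g Φ h i s) ^ α *
            ((c j : ℝ≥0∞) / c i) = ((Φ s j : ℝ≥0) : ℝ≥0∞) / (Φ s i : ℝ≥0) := by
          rw [transport, transport, hgc, hgc]
          exact rpow_div_mul_div_eq hα (hh0 s) (hc j) (hc i)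
        simp only [hΘ, coordOfRatio, h1]
        rw [iInf_div_eq hs, ENNReal.toNNReal_coe, min_eq_left (Φ s j).2.2]
      have hiff : s ∈ Θ ⁻¹' (Φ '' (B ∩ R)) ↔ s ∈ B := by
        rw [mem_preimage, hΘΦ]
        constructor
        · rintro ⟨s', ⟨hs'B, hs'R⟩, hs'⟩
          exact hinj hs'R hsR hs' ▸ hs'B
        · exact fun hsB => ⟨s, ⟨hsB, hsR⟩, rfl⟩
      rw [mem_symmDiff, hiff]
      tauto
    exact measure_eq_zero_iff_ae_notMem.2 hae

end Final

end FrechetProcess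

theorem theorem4p1 {T : Type*} [Nonempty T] {Ω : Type*} [MeasurableSpace Ω] (P : Measure Ω)
    [IsProbabilityMeasure P] (α : ℝ) (hα : 0 < α) (X : T → Ω → ℝ)
    (hX : FrechetProcess.IsFrechetProcess α X P) (hS : FrechetProcess.ConditionS X P) :
    ∃ (I : Fin 2) (N : ℕ∞) (f : T → FrechetProcess.stdSupport I N → ℝ≥0),
      FrechetProcess.IsSpectralRepresentation α X P (FrechetProcess.stdMeasure I N) f ∧
      FrechetProcess.IsMinimal α (FrechetProcess.stdMeasure I N) f := by
  open FrechetProcess in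
  choose V hV using hX.exists_hasFrechetLaw_sup hα
  obtain ⟨T₀, hT₀, hsep⟩ := hS
  have hT₀' : ∀ t, ∃ τ : ℕ → T₀, ∀ᵐ ω ∂P,
      Tendsto (fun n => powProcess α X (τ n) ω) atTop (𝓝 (powProcess α X t ω)) := by
    intro t
    obtain ⟨τ, hτ, hlim⟩ := hsep t
    obtain ⟨ns, -, hns⟩ := hlim.exists_seq_tendsto_ae
    refine ⟨fun n => ⟨τ (ns n), hτ _⟩, ?_⟩
    filter_upwards [hns] with ω hω
    exact ((NNReal.continuous_rpow_const hα.le).tendsto _).comp (tendsto_real_toNNReal hω)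
  obtain ⟨c, Q, g, _, hc, hg, hgc, hgV, hlim⟩ := exists_spectralFunctions hT₀ hV hT₀'
  have : Countable T₀ := hT₀.to_subtype
  have : Nonempty T₀ := ⟨(hT₀' (Classical.arbitrary T)).choose 0⟩
  obtain ⟨I, N, Φ, h, R, hΦ, hh, hh0, hR, hRnull, hinj, hint⟩ := exists_standardization Q
  have : StandardBorelSpace (stdSupport I N) := (measurableSet_stdSupport I N).standardBorel
  exact ⟨I, N, transport α g Φ h,
    isSpectralRepresentation_transport hα hX hV hg hgV hΦ hh hint,
    isMinimal_transport hα hc hgc hlim hΦ hh hh0 hR hRnull hinj hint⟩
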